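/- Work in ZFC. Throughout, $\chi$ denotes a regular cardinal, $\mathcal H_\chi$ is the set of all sets whose transitive closure has cardinality $<\chi$, and "for all sufficiently large $\chi$" means "for all regular $\chi\ge\chi_0$, for some cardinal $\chi_0$". For a set $M$ and a cardinal $\kappa$, $[M]^{\kappa}$ is the set of subsets of $M$ of cardinality $\kappa$; a family $\mathcal F$ is cofinal in $[M]^\kappa$ if every $X\in[M]^{\kappa}$ is contained in a member of $\mathcal F$. $M\prec\mathcal H_\chi$ means that $(M,\in)$ is an elementary submodel of $(\mathcal H_\chi,\in)$. A partial order $P$ is identified with its underlying set, except that "$P\in M$" means that the pair consisting of the underlying set and the order relation belongs to $M$. Definitions. - $\Box_{\omega_1}$: there is a sequence $\langle C_\alpha:\alpha<\omega_2,\ \alpha\text{ a limit ordinal}\rangle$ such that each $C_\alpha$ is closed and unbounded in $\alpha$ and has order type at most $\omega_1$, and $C_\beta=C_\alpha\cap\beta$ whenever $\beta<\alpha$ is a limit point of $C_\alpha$. - Let $P$ be a partial order, $Q\subseteq P$ with the induced order, and $\kappa$ a cardinal. Write $Q\le_{\kappa}P$ if for every $p\in P$ the set $\{q\in Q:q\le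 p\}$ has a cofinal subset of cardinality $<\kappa$ and the set $\{q\in Q:q\ge p\}$ has a coinitial subset of cardinality $<\kappa$. Write $Q\le_\sigma P$ for $Q\le_{\aleph_1}P$, i.e. these subsets can be chosen countable. - $\mathcal M_\chi$ is the set of all $M\prec\mathcal H_\chi$ with $|M|=\aleph_1$ such that $[M]^{\aleph_0}\cap M$ is cofinal in $[M]^{\aleph_0}$. - $\mathcal M^{\sqsubset}_\chi$ is the set of all $M\prec\mathcal H_\chi$ with $|M|=\aleph_1$ for which there is a (strict) well-ordering $\sqsubset$ of $M$ of order type $\omega_1$ such that for every $a\in M$, writing $M_{\sqsubset a}=\{x\in M:x\sqsubset a\}$, we have ${\sqsubset}\cap(M_{\sqsubset a})^2\in M$. - $\operatorname{SEP}(P)$: for all sufficiently large $\chi$, the family $\{M\in\mathcal M_\chi:P\cap M\le_\sigma P\}$ is cofinal in $[\mathcal H_\chi]^{\aleph_1}$. - $\operatorname{SEP}^+(P)$: for all sufficiently large $\chi$, the family $\{M\in\mathcal M^{\sqsubset}_\chi:P\cap M\le_\sigma P\}$ is cofinal in $[\mathcal H_\chi]^{\aleph_1}$. - $P$ has the $\aleph_2$-IDP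 if for all sufficiently large $\chi$ and all $M\prec\mathcal H_\chi$ such that $|M|=\aleph_2$, $P\in M$ and $[M]^{\aleph_1}\cap M$ is cofinal in $[M]^{\aleph_1}$, we have $P\cap M\le_{\aleph_2}P$. Theorem. Assume $\Box_{\omega_1}$. Then for every partial order $P$ with the $\aleph_2$-IDP, $\operatorname{SEP}(P)$ holds if and only if $\operatorname{SEP}^+(P)$ holds. -/

import Mathlib

open Cardinal Ordinal FirstOrder

universe u

/-! ### The square principle at `ω₁` -/

/-- `β` is a limit point of `C`: `β ≠ 0` and `C ∩ β` is unbounded in `β`. -/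
def IsLimitPointOf (β : Ordinal.{u}) (C : Set Ordinal.{u}) : Prop :=
  β ≠ 0 ∧ ∀ γ < β, ∃ δ ∈ C, γ < δ ∧ δ < β

/-- `C` is a closed unbounded subset of the (limit) ordinal `α`. -/
structure IsClubIn (C : Set Ordinal.{u}) (α : Ordinal.{u}) : Prop where
  subset : ∀ β ∈ C, β < α
  unbounded : ∀ γ < α, ∃ δ ∈ C, γ < δ
  closed : ∀ β < α, IsLimitPointOf β C → β ∈ C

/-- Jensen's principle `□_{ω₁}`: there is a sequence `⟨C α : α < ω₂ limit⟩` such that each `C α`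
is club in `α`, of order type at most `ω₁`, and `C β = C α ∩ β` for every limit point `β < α`
of `C α`. -/
def SquareOmegaOne : Prop :=
  ∃ C : Ordinal.{u} → Set Ordinal.{u}, ∀ α : Ordinal.{u}, α < ω_ 2 → Order.IsSuccLimit α →
    IsClubIn (C α) α ∧
    Ordinal.type (fun x y : C α => x < y) ≤ ω_ 1 ∧
    ∀ β < α, IsLimitPointOf β (C α) → C β = C α ∩ Set.Iio β

/-! ### Elementary submodels of `HSets χ` -/

/-- The only symbol of the language of set theory: a binary relation symbol. -/
inductive SetSymb : ℕ → Type
  | mem : SetSymb 2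

/-- The first-order language of set theory. -/
def setLanguage : FirstOrder.Language.{0, 0} := ⟨fun _ => Empty, SetSymb⟩

/-- Every collection of sets is a structure for the language of set theory, with true `∈`. -/
instance setStructure (M : Set ZFSet.{u}) : setLanguage.Structure M where
  funMap := fun f _ => Empty.elim f
  RelMap := fun r => match r with
    | .mem => fun x => (x 0 : ZFSet.{u}) ∈ (x 1 : ZFSet.{u})

/-- `M ≼ N`: `M` is contained in `N` and the inclusion is elementary for `∈`. -/
def IsElemSubmodel (M N : Set ZFSet.{u}) : Prop :=
  ∃ f : M ↪ₑ[setLanguage] N, ∀ x : M, (f x : ZFSet.{u}) = x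

/-- The transitive closure of `x` (without `x` itself). -/
def trcl (x : ZFSet.{u}) : Set ZFSet.{u} := {y | Relation.TransGen (· ∈ ·) y x}

/-- The collection `HSets χ` of all sets hereditarily of cardinality less than `χ`. -/
def HSets (χ : Cardinal.{u}) : Set ZFSet.{u} := {x | #(trcl x) < Cardinal.lift.{u + 1} χ}

/-- `[M]^κ ∩ M` is cofinal in `[M]^κ`. -/
def CofinalCovering (κ : Cardinal.{u}) (M : Set ZFSet.{u}) : Prop :=
  ∀ X : Set ZFSet.{u}, X ⊆ M → #X = Cardinal.lift.{u + 1} κ →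
    ∃ Y : ZFSet.{u}, Y ∈ M ∧ (Y : Set ZFSet.{u}) ⊆ M ∧ Y.card = κ ∧ X ⊆ (Y : Set ZFSet.{u})

/-- The class `𝓜_χ` of elementary submodels `M` of `HSets χ` of cardinality `ℵ₁` such that
`[M]^{ℵ₀} ∩ M` is cofinal in `[M]^{ℵ₀}`. -/
def GoodModels (χ : Cardinal.{u}) : Set (Set ZFSet.{u}) :=
  {M | IsElemSubmodel M (HSets χ) ∧ #M = ℵ_ 1 ∧ CofinalCovering ℵ₀ M}

/-- The class `𝓜^⊏_χ` of elementary submodels `M` of `HSets χ` of cardinality `ℵ₁` which have a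
(strict) well-ordering `⊏` of order type `ω₁` such that, for every `a ∈ M`, the restriction of `⊏`
to `{x ∈ M : x ⊏ a}`, as a set of ordered pairs, is an element of `M`. -/
def OrderedGoodModels (χ : Cardinal.{u}) : Set (Set ZFSet.{u}) :=
  {M | IsElemSubmodel M (HSets χ) ∧ #M = ℵ_ 1 ∧
    ∃ (r : M → M → Prop) (_ : IsWellOrder M r), Ordinal.type r = ω_ 1 ∧
      ∀ a : M, ∃ s ∈ M, ∀ z : ZFSet.{u}, z ∈ s ↔
        ∃ x y : M, r x a ∧ r y a ∧ r x y ∧ z = ZFSet.pair x y}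

/-- `F` is cofinal in `[N]^{ℵ₁}`. -/
def IsCofinalFamily (F : Set (Set ZFSet.{u})) (N : Set ZFSet.{u}) : Prop :=
  ∀ X : Set ZFSet.{u}, X ⊆ N → #X = ℵ_ 1 → ∃ M ∈ F, X ⊆ M

/-- `Φ χ` holds for all sufficiently large regular cardinals `χ`. -/
def ForLargeRegular (Φ : Cardinal.{u} → Prop) : Prop :=
  ∃ χ₀ : Cardinal.{u}, ∀ χ : Cardinal.{u}, χ₀ ≤ χ → χ.IsRegular → Φ χ

/-! ### Partial orders -/

/-- A partial order, as an object of the universe of sets: a set `carrier` together with a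
set `rel` of ordered pairs that is a (reflexive) partial order on `carrier`. -/
structure SetPoset where
  carrier : ZFSet.{u}
  rel : ZFSet.{u}
  rel_subset : rel ⊆ ZFSet.prod carrier carrier
  refl : ∀ x ∈ carrier, ZFSet.pair x x ∈ rel
  antisymm : ∀ x y, ZFSet.pair x y ∈ rel → ZFSet.pair y x ∈ rel → x = y
  trans : ∀ x y z, ZFSet.pair x y ∈ rel → ZFSet.pair y z ∈ rel → ZFSet.pair x z ∈ rel

namespace SetPoset

/-- The partial order itself, as a set: the ordered pair of its underlying set and its order. -/
def toSet (P : SetPoset.{u}) : ZFSet.{u} := ZFSet.pair P.carrier P.rel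

/-- The order relation of `P`. -/
def Le (P : SetPoset.{u}) (x y : ZFSet.{u}) : Prop := ZFSet.pair x y ∈ P.rel

/-- `P ∩ M`: the elements of `P` lying in `M` (with the order of `P`). -/
def trace (P : SetPoset.{u}) (M : Set ZFSet.{u}) : Set ZFSet.{u} := {x | x ∈ P.carrier ∧ x ∈ M}

/-- For a suborder `Q` of `P`: for every `p ∈ P`, the set `{q ∈ Q : q ≤ p}` has a cofinal subset
of cardinality `< κ` and `{q ∈ Q : p ≤ q}` has a coinitial subset of cardinality `< κ`. -/
def SubordLt (P : SetPoset.{u}) (κ : Cardinal.{u}) (Q : Set ZFSet.{u}) : Prop :=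
  ∀ p ∈ P.carrier,
    (∃ C : Set ZFSet.{u}, C ⊆ {q | q ∈ Q ∧ P.Le q p} ∧ #C < Cardinal.lift.{u + 1} κ ∧
      ∀ q ∈ Q, P.Le q p → ∃ c ∈ C, P.Le q c) ∧
    (∃ C : Set ZFSet.{u}, C ⊆ {q | q ∈ Q ∧ P.Le p q} ∧ #C < Cardinal.lift.{u + 1} κ ∧
      ∀ q ∈ Q, P.Le p q → ∃ c ∈ C, P.Le c q)

/-- `Q ≤_σ P`: the cofinal and coinitial subsets can be taken countable, that is, of
cardinality `< ℵ₁`. -/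
def SubordSigma (P : SetPoset.{u}) (Q : Set ZFSet.{u}) : Prop := P.SubordLt (ℵ_ 1) Q

/-- `SEP(P)`. -/
def SEP (P : SetPoset.{u}) : Prop :=
  ForLargeRegular fun χ =>
    IsCofinalFamily {M | M ∈ GoodModels χ ∧ P.SubordSigma (P.trace M)} (HSets χ)

/-- `SEP⁺(P)`. -/
def SEPPlus (P : SetPoset.{u}) : Prop :=
  ForLargeRegular fun χ =>
    IsCofinalFamily {M | M ∈ OrderedGoodModels χ ∧ P.SubordSigma (P.trace M)} (HSets χ)

/-- The `ℵ₂`-IDP: for all sufficiently large regular `χ` and all `M ≼ HSets χ` of cardinality `ℵ₂`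
with `P ∈ M` such that `[M]^{ℵ₁} ∩ M` is cofinal in `[M]^{ℵ₁}`, one has `P ∩ M ≤_{ℵ₂} P`. -/
def AlephTwoIDP (P : SetPoset.{u}) : Prop :=
  ForLargeRegular fun χ =>
    ∀ M : Set ZFSet.{u}, IsElemSubmodel M (HSets χ) → #M = ℵ_ 2 → P.toSet ∈ M →
      CofinalCovering (ℵ_ 1) M → P.SubordLt (ℵ_ 2) (P.trace M)

end SetPoset

/-! ### Elementary submodels -/

namespace IsElemSubmodel

variable {M N : Set ZFSet.{u}}

/-! From SEP⁺ to SEP: in a model ordered by ⊏ in type ω₁, a countable set X lies below some a. The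
predecessors of a form a countable set, definable from a restriction of ⊏ that belongs to the model,
so the model covers X (`orderedGoodModels_subset`).

From SEP to SEP⁺: build an increasing chain of SEP models A_α, α < ω₂, each containing its
predecessors as elements (`exists_isModelChain`). Every subset of size ℵ₁ of the union N lies in
some A_α, and A_α ∈ N, so the IDP applies to N: for each p ∈ P, the parts of P ∩ N below and above p
are controlled by a single A_α. Now take a SEP model M that knows the chain, and let δ be the least
index with A_δ ∉ M. The model sought is N ∩ M, which is the union of the A_α with α < δ.

It is σ-embedded in P by composing approximations: p is approximated by countably many b ∈ P ∩ M,
the part of N on the relevant side of b by some A_α ∈ M, and that A_α by a countable set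
(`IsReflecting.subordSigma`).

Its ordering comes from the square. Countable covering in M gives δ uncountable cofinality.
Enumerating the A_γ, γ ∈ C_δ, in parallel orders the union in type ω₁, and each proper initial
segment uses only C_δ ∩ β for some limit point β < δ of C_δ. By coherence this set is C_β, so the
segment was already put into A_β (`IsHeight.mem_orderedGoodModels`). -/

theorem subset (h : IsElemSubmodel M N) : M ⊆ N := by
  obtain ⟨f, hf⟩ := h
  intro x hx
  have := (f ⟨x, hx⟩).2
  rwa [hf] at this

theorem exists_realize (h : IsElemSubmodel M N) {α : Type*} {n : ℕ}
    (φ : setLanguage.BoundedFormula α (n + 1)) (v : α → M) (w : Fin n → M) (a : N)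
    (ha : φ.Realize (fun i => (⟨v i, h.subset (v i).2⟩ : N))
      (Fin.snoc (fun i => (⟨w i, h.subset (w i).2⟩ : N)) a : Fin (n + 1) → N)) :
    ∃ b : M, φ.Realize (fun i => (⟨v i, h.subset (v i).2⟩ : N))
      (Fin.snoc (fun i => (⟨w i, h.subset (w i).2⟩ : N))
        ⟨b, h.subset b.2⟩ : Fin (n + 1) → N) := by
  have hs := h.subset
  obtain ⟨f, hf⟩ := h
  have key : ∀ x : M, (⟨x, hs x.2⟩ : N) = f x := fun x => Subtype.ext (hf x).symm
  simp only [key] at ha ⊢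
  have h1 : φ.ex.Realize (f ∘ v) (f ∘ w) := by
    rw [Language.BoundedFormula.realize_ex]
    exact ⟨a, ha⟩
  rw [f.map_boundedFormula, Language.BoundedFormula.realize_ex] at h1
  obtain ⟨b, hb⟩ := h1
  refine ⟨b, ?_⟩
  rw [← f.map_boundedFormula, Fin.comp_snoc] at hb
  exact hb

theorem of_exists (hs : M ⊆ N)
    (H : ∀ (n : ℕ) (φ : setLanguage.BoundedFormula Empty (n + 1)) (w : Fin n → M) (a : N),
      φ.Realize default (Fin.snoc (fun i => (⟨w i, hs (w i).2⟩ : N)) a : Fin (n + 1) → N) →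
      ∃ b : M, φ.Realize default (Fin.snoc (fun i => (⟨w i, hs (w i).2⟩ : N))
        ⟨b, hs b.2⟩ : Fin (n + 1) → N)) : IsElemSubmodel M N := by
  let g : M ↪[setLanguage] N :=
    { toFun := Set.inclusion hs
      inj' := Set.inclusion_injective hs
      map_fun' := fun f => Empty.elim f
      map_rel' := by
        intro n r x
        cases r
        exact Iff.rfl }
  exact ⟨g.toElementaryEmbedding H, fun x => rfl⟩

/-- The union of a directed family of elementary submodels is an elementary submodel. -/
theorem sUnion {F : Set (Set ZFSet.{u})} (hne : F.Nonempty)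
    (hdir : DirectedOn (· ⊆ ·) F) (hF : ∀ A ∈ F, IsElemSubmodel A N) :
    IsElemSubmodel (⋃₀ F) N := by
  refine of_exists (Set.sUnion_subset fun A hA => (hF A hA).subset) ?_
  intro n φ w a ha
  have : ∃ A ∈ F, ∀ i, (w i : ZFSet) ∈ A := by
    have hfin : (Set.range fun i => (w i : ZFSet.{u})).Finite := Set.finite_range _
    have hsub : (Set.range fun i => (w i : ZFSet.{u})) ⊆ ⋃₀ F := by
      rintro _ ⟨i, rfl⟩
      exact (w i).2
    obtain ⟨A, hA, hsub⟩ := hdir.exists_mem_subset_of_finite_of_subset_sUnion hne hfin hsub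
    exact ⟨A, hA, fun i => hsub ⟨i, rfl⟩⟩
  obtain ⟨A, hA, hw⟩ := this
  have e : ∀ x : Empty → N, x = default := fun x => Subsingleton.elim _ _
  obtain ⟨b, hb⟩ := (hF A hA).exists_realize φ Empty.elim (fun i => ⟨w i, hw i⟩) a
    (by rwa [e (fun i => _)])
  rw [e (fun i => _)] at hb
  exact ⟨⟨b, A, hA, b.2⟩, hb⟩

end IsElemSubmodel

/-- The formula `s ∈ t`. -/
def memFormula {α : Type} {n : ℕ} (s t : setLanguage.Term (α ⊕ Fin n)) :
    setLanguage.BoundedFormula α n :=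
  Language.Relations.boundedFormula₂ (L := setLanguage) SetSymb.mem s t

theorem realize_memFormula {N : Set ZFSet.{u}} {α : Type} {n : ℕ}
    (s t : setLanguage.Term (α ⊕ Fin n)) (v : α → N) (w : Fin n → N) :
    (memFormula s t).Realize v w ↔
      ((s.realize (Sum.elim v w) : N) : ZFSet.{u}) ∈
        ((t.realize (Sum.elim v w) : N) : ZFSet.{u}) :=
  Language.BoundedFormula.realize_rel₂ (L := setLanguage)

/-- A transitive class closed under the formation of unordered pairs. -/
structure IsPairClosed (N : Set ZFSet.{u}) : Prop where
  mem_of_mem : ∀ x ∈ N, ∀ y ∈ x, y ∈ N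
  pair_mem : ∀ x ∈ N, ∀ y ∈ N, ({x, y} : ZFSet) ∈ N

namespace IsElemSubmodel

variable {M N : Set ZFSet.{u}}

/-- The Tarski–Vaught property with the formula hidden behind its meaning `R` in `N`, so that each
closure property below costs one formula and one unfolding. -/
theorem exists_of_definable (h : IsElemSubmodel M N) {α : Type}
    (φ : setLanguage.BoundedFormula α (0 + 1)) (v : α → M) (R : ZFSet.{u} → Prop)
    (hφ : ∀ b : N, φ.Realize (fun i => (⟨v i, h.subset (v i).2⟩ : N))
      (Fin.snoc (fun i => Fin.elim0 i) b : Fin (0 + 1) → N) ↔ R b)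
    {a : ZFSet.{u}} (ha : a ∈ N) (haR : R a) : ∃ b ∈ M, R b := by
  have e : ∀ x : Fin 0 → N, x = fun i => Fin.elim0 i := fun x => Subsingleton.elim _ _
  obtain ⟨b, hb⟩ := h.exists_realize φ v Fin.elim0 ⟨a, ha⟩ (by
    rw [e (fun i => _)]
    exact (hφ ⟨a, ha⟩).2 haR)
  rw [e (fun i => _)] at hb
  exact ⟨b, b.2, (hφ _).1 hb⟩

open Language in
theorem sUnion_mem (h : IsElemSubmodel M N) (ht : IsPairClosed N) {s : ZFSet.{u}} (hs : s ∈ M)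
    (hU : ZFSet.sUnion s ∈ N) : ZFSet.sUnion s ∈ M := by
  let φ : setLanguage.BoundedFormula (Fin 1) (0 + 1) :=
    ∀' ((memFormula (&1) (&0)).iff
      (∃' (memFormula (&2) (.var (.inl 0)) ⊓ memFormula (&1) (&2))))
  obtain ⟨b, hb, hbR⟩ := h.exists_of_definable φ (fun _ => ⟨s, hs⟩)
    (fun b => ∀ x : N, (x : ZFSet) ∈ b ↔ ∃ y : N, (y : ZFSet) ∈ s ∧ (x : ZFSet) ∈ (y : ZFSet))
    (by
      intro b
      simp [φ, realize_memFormula, Fin.snoc])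
    hU (by
      intro x
      rw [ZFSet.mem_sUnion]
      exact ⟨fun ⟨y, hy, hx⟩ => ⟨⟨y, ht.mem_of_mem _ (h.subset hs) _ hy⟩, hy, hx⟩,
        fun ⟨y, hy, hx⟩ => ⟨y, hy, hx⟩⟩)
  have : b = ZFSet.sUnion s := by
    ext x
    rw [ZFSet.mem_sUnion]
    constructor
    · intro hx
      obtain ⟨y, hy, hxy⟩ := (hbR ⟨x, ht.mem_of_mem _ (h.subset hb) _ hx⟩).1 hx
      exact ⟨y, hy, hxy⟩
    · rintro ⟨y, hy, hxy⟩
      have hyN := ht.mem_of_mem _ (h.subset hs) _ hy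
      exact (hbR ⟨x, ht.mem_of_mem _ hyN _ hxy⟩).2 ⟨⟨y, hyN⟩, hy, hxy⟩
  exact this ▸ hb

open Language in
/-- If some element of `A` contains all elements of `A ∩ Y`, then some such element of `A` lies
in `M`. -/
theorem exists_bound (h : IsElemSubmodel M N) (ht : IsPairClosed N) {A Y a : ZFSet.{u}}
    (hA : A ∈ M) (hY : Y ∈ M) (ha : a ∈ A) (hb : ∀ b ∈ Y, b ∈ A → b ∈ a) :
    ∃ a ∈ M, a ∈ A ∧ ∀ b ∈ Y, b ∈ A → b ∈ a := by
  let φ : setLanguage.BoundedFormula (Fin 2) (0 + 1) :=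
    memFormula (&0) (.var (.inl 0)) ⊓
    ∀' ((memFormula (&1) (.var (.inl 1))).imp
      ((memFormula (&1) (.var (.inl 0))).imp (memFormula (&1) (&0))))
  obtain ⟨b, hb, hbR⟩ := h.exists_of_definable φ ![⟨A, hA⟩, ⟨Y, hY⟩]
    (fun a => a ∈ A ∧ ∀ b : N, (b : ZFSet) ∈ Y → (b : ZFSet) ∈ A → (b : ZFSet) ∈ a)
    (by
      intro b
      simp [φ, realize_memFormula, Fin.snoc])
    (ht.mem_of_mem _ (h.subset hA) _ ha) ⟨ha, fun b => hb b⟩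
  exact ⟨b, hb, hbR.1, fun c hc => hbR.2 ⟨c, ht.mem_of_mem _ (h.subset hY) _ hc⟩ hc⟩

open Language in
/-- `M` is closed under the (multivalued) functions belonging to it. -/
theorem exists_pair_mem (h : IsElemSubmodel M N) (ht : IsPairClosed N) {f x y : ZFSet.{u}}
    (hf : f ∈ M) (hx : x ∈ M) (hxy : ZFSet.pair x y ∈ f) : ∃ y ∈ M, ZFSet.pair x y ∈ f := by
  let φ : setLanguage.BoundedFormula (Fin 2) (0 + 1) :=
    ∃' (memFormula (&1) (.var (.inl 0)) ⊓
      ∀' ((memFormula (&2) (&1)).iff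
        (∀' ((memFormula (&3) (&2)).iff (&3 =' (.var (.inl 1)))) ⊔
          ∀' ((memFormula (&3) (&2)).iff (&3 =' (.var (.inl 1)) ⊔ &3 =' &0)))))
  have hfN := h.subset hf
  have hxN := h.subset hx
  have hpN := ht.mem_of_mem _ hfN _ hxy
  have hyN : y ∈ N := by
    have : ({x, y} : ZFSet) ∈ N := ht.mem_of_mem _ hpN _ (by simp [ZFSet.pair])
    exact ht.mem_of_mem _ this _ (by simp)
  -- The definition of the Kuratowski pair is absolute for `N`: transitivity and closure under pairs
  -- put `{x}` and `{x, y}` into `N`.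
  have key : ∀ y ∈ N, (∃ p : N, (p : ZFSet) ∈ f ∧ ∀ z : N, (z : ZFSet) ∈ (p : ZFSet) ↔
      ((∀ w : N, (w : ZFSet) ∈ (z : ZFSet) ↔ (w : ZFSet) = x) ∨
      (∀ w : N, (w : ZFSet) ∈ (z : ZFSet) ↔ (w : ZFSet) = x ∨ (w : ZFSet) = y))) ↔
      ZFSet.pair x y ∈ f := by
    intro y hy
    have e1 : ∀ z ∈ N, (∀ w : N, (w : ZFSet) ∈ (z : ZFSet) ↔ (w : ZFSet) = x) ↔ z = {x} := by
      intro z hz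
      constructor
      · intro H
        ext w
        rw [ZFSet.mem_singleton]
        exact ⟨fun hw => (H ⟨w, ht.mem_of_mem _ hz _ hw⟩).1 hw,
          fun hw => (H ⟨w, hw ▸ hxN⟩).2 hw⟩
      · rintro rfl w
        simp
    have e2 : ∀ z ∈ N, (∀ w : N, (w : ZFSet) ∈ (z : ZFSet) ↔
        (w : ZFSet) = x ∨ (w : ZFSet) = y) ↔ z = {x, y} := by
      intro z hz
      constructor
      · intro H
        ext w
        rw [ZFSet.mem_pair]
        exact ⟨fun hw => (H ⟨w, ht.mem_of_mem _ hz _ hw⟩).1 hw,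
          fun hw => (H ⟨w, by rcases hw with rfl | rfl <;> assumption⟩).2 hw⟩
      · rintro rfl w
        simp
    have hs1 : ({x} : ZFSet) ∈ N := by
      have := ht.pair_mem x hxN x hxN
      rwa [ZFSet.pair_eq_singleton] at this
    constructor
    · rintro ⟨p, hp, H⟩
      convert hp
      ext z
      simp only [ZFSet.pair, ZFSet.mem_pair]
      constructor
      · rintro hz
        have hzN : z ∈ N := by
          rcases hz with rfl | rfl
          · exact hs1
          · exact ht.pair_mem _ hxN _ hy
        rw [H ⟨z, hzN⟩, e1 z hzN, e2 z hzN]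
        exact hz
      · intro hz
        have hzN := ht.mem_of_mem _ p.2 _ hz
        have := (H ⟨z, hzN⟩).1 hz
        rwa [e1 z hzN, e2 z hzN] at this
    · intro hp
      refine ⟨⟨_, ht.mem_of_mem _ hfN _ hp⟩, hp, fun z => ?_⟩
      rw [e1 z z.2, e2 z z.2]
      simp [ZFSet.pair]
  obtain ⟨b, hb, hbR⟩ := h.exists_of_definable φ ![⟨f, hf⟩, ⟨x, hx⟩]
    (fun y => ∃ p : N, (p : ZFSet) ∈ f ∧ ∀ z : N, (z : ZFSet) ∈ (p : ZFSet) ↔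
      ((∀ w : N, (w : ZFSet) ∈ (z : ZFSet) ↔ (w : ZFSet) = x) ∨
      (∀ w : N, (w : ZFSet) ∈ (z : ZFSet) ↔ (w : ZFSet) = x ∨ (w : ZFSet) = y)))
    (by
      intro b
      simp [φ, realize_memFormula, Fin.snoc, Subtype.ext_iff])
    hyN ((key y hyN).2 hxy)
  exact ⟨b, hb, (key b (h.subset hb)).1 hbR⟩

end IsElemSubmodel

/-! ### Sets of hereditarily small cardinality -/

theorem trcl_eq (x : ZFSet.{u}) : trcl x = (x : Set ZFSet.{u}) ∪ ⋃ y : (x : Set ZFSet.{u}), trcl y := by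
  ext z
  simp only [trcl, Set.mem_ofPred_eq, Set.mem_union, Set.mem_iUnion, Subtype.exists]
  rw [Relation.transGen_iff]
  simp [SetLike.mem_coe]
  grind

theorem subset_trcl (x : ZFSet.{u}) : (x : Set ZFSet.{u}) ⊆ trcl x :=
  fun _ h => Relation.TransGen.single h

theorem trcl_subset_of_mem {x y : ZFSet.{u}} (h : y ∈ x) : trcl y ⊆ trcl x :=
  fun _ hz => Relation.TransGen.tail hz h

instance small_trcl (x : ZFSet.{u}) : Small.{u} (trcl x) := by
  induction x using ZFSet.inductionOn with
  | _ x ih =>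
    rw [trcl_eq]
    have (y : (x : Set ZFSet.{u})) : Small.{u} (trcl y) := ih y y.2
    have hx : Small.{u} (x : Set ZFSet.{u}) := ZFSet.small_coe x
    exact small_union _ _

theorem small_of_mk_le_lift {T : Set ZFSet.{u}} {c : Cardinal.{u}}
    (h : #T ≤ Cardinal.lift.{u + 1} c) : Small.{u} T := by
  obtain ⟨d, hd⟩ := mem_range_lift_of_le h
  obtain ⟨e⟩ := Cardinal.lift_mk_eq'.1 (show Cardinal.lift.{u + 1} #d.out = Cardinal.lift.{u} #T by
    rw [mk_out, Cardinal.lift_id'.{u, u + 1}, hd])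
  exact ⟨_, ⟨e.symm⟩⟩

theorem exists_coe_eq (T : Set ZFSet.{u}) [Small.{u} T] :
    ∃ x : ZFSet.{u}, (x : Set ZFSet.{u}) = T :=
  ⟨ZFSet.range (Subtype.val : T → ZFSet.{u}), by simp⟩

namespace HSets

variable {χ : Cardinal.{u}}

theorem mem_of_mem {x y : ZFSet.{u}} (hx : x ∈ HSets χ) (h : y ∈ x) : y ∈ HSets χ :=
  (mk_le_mk_of_subset (trcl_subset_of_mem h)).trans_lt hx

theorem mk_lt {x : ZFSet.{u}} (hx : x ∈ HSets χ) :
    #(x : Set ZFSet.{u}) < Cardinal.lift.{u + 1} χ :=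
  (mk_le_mk_of_subset (subset_trcl x)).trans_lt hx

/-- The transitive closure of `x` is `x` together with fewer than `χ` sets of size below `χ`;
regularity bounds the union. -/
theorem mem_of_mk_lt (hχ : χ.IsRegular) {x : ZFSet.{u}} (hs : ∀ y ∈ x, y ∈ HSets χ)
    (hc : #(x : Set ZFSet.{u}) < Cardinal.lift.{u + 1} χ) : x ∈ HSets χ := by
  have hχ' : (Cardinal.lift.{u + 1} χ).IsRegular := hχ.lift
  change #(trcl x) < _
  rw [trcl_eq]
  refine (mk_union_le _ _).trans_lt (add_lt_of_lt hχ'.aleph0_le hc ?_)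
  exact (card_iUnion_lt_iff_forall_of_isRegular hχ' hc).2 fun y => hs y y.2

theorem exists_of_mk_lt (hχ : χ.IsRegular) {T : Set ZFSet.{u}} (hs : T ⊆ HSets χ)
    (hc : #T < Cardinal.lift.{u + 1} χ) :
    ∃ x ∈ HSets χ, (x : Set ZFSet.{u}) = T := by
  have := small_of_mk_le_lift hc.le
  obtain ⟨x, rfl⟩ := exists_coe_eq T
  exact ⟨x, mem_of_mk_lt hχ hs hc, rfl⟩

theorem isPairClosed (hχ : χ.IsRegular) : IsPairClosed (HSets χ) where
  mem_of_mem _ hx _ hy := mem_of_mem hx hy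
  pair_mem x hx y hy := by
    refine mem_of_mk_lt hχ (by simp [hx, hy]) (lt_of_lt_of_le ?_ (aleph0_le_lift.2 hχ.aleph0_le))
    have : (({x, y} : ZFSet.{u}) : Set ZFSet.{u}) = {x, y} := by ext; simp
    rw [this, Cardinal.lt_aleph0_iff_set_finite]
    exact Set.toFinite _

theorem pair_mem (hχ : χ.IsRegular) {x y : ZFSet.{u}} (hx : x ∈ HSets χ) (hy : y ∈ HSets χ) :
    ZFSet.pair x y ∈ HSets χ := by
  have h := (isPairClosed hχ).pair_mem
  have hxx := h x hx x hx
  rw [ZFSet.pair_eq_singleton] at hxx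
  exact h _ hxx _ (h x hx y hy)

theorem sUnion_mem {x : ZFSet.{u}} (hx : x ∈ HSets χ) :
    ZFSet.sUnion x ∈ HSets χ := by
  refine (mk_le_mk_of_subset ?_).trans_lt hx
  rw [trcl_eq]
  refine Set.union_subset ?_ (Set.iUnion_subset fun y => ?_)
  · intro z hz
    obtain ⟨y, hy, hz⟩ := ZFSet.mem_sUnion.1 hz
    exact trcl_subset_of_mem hy (subset_trcl y hz)
  · obtain ⟨z, hz, hy⟩ := ZFSet.mem_sUnion.1 y.2
    exact (trcl_subset_of_mem hy).trans (trcl_subset_of_mem hz)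

end HSets

/-! ### Well-orderings of type `ω₁` along a thread of sets of size `ℵ₁` -/

theorem exists_rank_of_mk_le_aleph_one {α : Type u} {S : Set α} (h : #S ≤ ℵ_ 1) :
    ∃ f : α → Ordinal.{u}, S.InjOn f ∧ ∀ x ∈ S, f x < ω_ 1 := by
  classical
  rw [← card_omega, ← mk_toType] at h
  obtain ⟨e⟩ := h
  refine ⟨fun x => if hx : x ∈ S then
    (Ordinal.ToType.mk.symm (e ⟨x, hx⟩) : Set.Iio (ω_ (1 : Ordinal.{u}))) else 0, ?_, ?_⟩
  · intro x hx y hy hxy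
    simp only [hx, hy, dif_pos] at hxy
    simpa using e.injective (Ordinal.ToType.mk.symm.injective (Subtype.ext hxy))
  · intro x hx
    simp only [hx, dif_pos]
    exact (Ordinal.ToType.mk.symm (e ⟨x, hx⟩)).2

theorem countable_Iic_of_lt_omega_one {ξ : Ordinal.{u}} (h : ξ < ω_ 1) :
    (Set.Iic ξ).Countable := by
  have h1 : Order.succ ξ < ω_ 1 := (isSuccLimit_omega 1).succ_lt h
  rw [← ord_aleph, lt_ord] at h1
  rw [← Order.Iio_succ, ← le_aleph0_iff_set_countable, Cardinal.mk_Iio_ordinal, lift_le_aleph0,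
    ← Order.lt_succ_iff, succ_aleph0]
  exact h1

open Classical in
/-- For a set `S` of cardinality at most `ℵ₁`, a function which is injective on `S` with values
below `ω₁`. -/
noncomputable def rankFun (S : Set ZFSet.{u}) : ZFSet.{u} → Ordinal.{u + 1} :=
  if h : #S ≤ ℵ_ 1 then (exists_rank_of_mk_le_aleph_one h).choose else fun _ => 0

theorem injOn_rankFun {S : Set ZFSet.{u}} (h : #S ≤ ℵ_ 1) : S.InjOn (rankFun S) := by
  rw [rankFun, dif_pos h]
  exact (exists_rank_of_mk_le_aleph_one h).choose_spec.1

theorem rankFun_lt {S : Set ZFSet.{u}} (h : #S ≤ ℵ_ 1) {x : ZFSet.{u}} (hx : x ∈ S) :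
    rankFun S x < ω_ 1 := by
  rw [rankFun, dif_pos h]
  exact (exists_rank_of_mk_le_aleph_one h).choose_spec.2 x hx

/-- The order type of `C ∩ γ`. -/
noncomputable def posIn (C : Set Ordinal.{u}) (γ : Ordinal.{u}) : Ordinal.{u + 1} :=
  Ordinal.type (fun x y : ↥(C ∩ Set.Iio γ) => x < y)

theorem posIn_inter_Iio {C : Set Ordinal.{u}} {β γ : Ordinal.{u}} (h : γ ≤ β) :
    posIn (C ∩ Set.Iio β) γ = posIn C γ := by
  have : C ∩ Set.Iio β ∩ Set.Iio γ = C ∩ Set.Iio γ := by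
    rw [Set.inter_assoc, Set.Iio_inter_Iio, min_eq_right h]
  have key : ∀ S T : Set Ordinal.{u}, S = T →
      Ordinal.type (fun x y : S => x < y) = Ordinal.type (fun x y : T => x < y) := by
    rintro S _ rfl
    rfl
  exact key _ _ this

theorem posIn_eq_typein {C : Set Ordinal.{u}} {γ : Ordinal.{u}} (h : γ ∈ C) :
    posIn C γ = Ordinal.typein (fun x y : C => x < y) ⟨γ, h⟩ := by
  refine Ordinal.type_eq.2 ⟨⟨⟨fun x => ⟨⟨x, x.2.1⟩, x.2.2⟩, fun x => ⟨x.1, x.1.2, x.2⟩,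
    fun _ => rfl, fun _ => rfl⟩, Iff.rfl⟩⟩

theorem posIn_lt {C : Set Ordinal.{u}} {γ : Ordinal.{u}} (h : γ ∈ C) {o : Ordinal.{u + 1}}
    (ho : Ordinal.type (fun x y : C => x < y) ≤ o) : posIn C γ < o := by
  rw [posIn_eq_typein h]
  exact (Ordinal.typein_lt_type _ _).trans_le ho

theorem injOn_posIn (C : Set Ordinal.{u}) : C.InjOn (posIn C) := by
  intro x hx y hy hxy
  rw [posIn_eq_typein hx, posIn_eq_typein hy, Ordinal.typein_inj] at hxy
  exact congrArg Subtype.val hxy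

theorem countable_posIn_le (C : Set Ordinal.{u}) {ξ : Ordinal.{u + 1}} (hξ : ξ < ω_ 1) :
    {γ ∈ C | posIn C γ ≤ ξ}.Countable :=
  Set.MapsTo.countable_of_injOn (fun _ h => h.2) ((injOn_posIn C).mono fun _ h => h.1)
    (countable_Iic_of_lt_omega_one hξ)

namespace Thread

variable (A A' : Ordinal.{u} → Set ZFSet.{u}) (C C' : Set Ordinal.{u}) (x y a : ZFSet.{u})

/-- The union of the sets `A γ` for `γ ∈ C`. -/
def union : Set ZFSet.{u} := {x | ∃ γ ∈ C, x ∈ A γ}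

/-- The ordinals that bound both the position of some `γ ∈ C` and the rank of `x` in `A γ`. -/
def levels : Set Ordinal.{u + 1} :=
  {ξ | ∃ γ ∈ C, x ∈ A γ ∧ posIn C γ ≤ ξ ∧ rankFun (A γ) x ≤ ξ}

/-- The stage at which `x` is enumerated. -/
noncomputable def level : Ordinal.{u + 1} := sInf (levels A C x)

/-- The order of enumeration, ties being broken by a global well-ordering. -/
noncomputable def lt : Prop :=
  Prod.Lex (· < ·) WellOrderingRel (level A C x, x) (level A C y, y)

/-- The restriction of `Thread.lt` to the elements below `a`, as a set of ordered pairs. -/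
def segment : Set ZFSet.{u} :=
  {z | ∃ x ∈ union A C, ∃ y ∈ union A C,
    lt A C x a ∧ lt A C y a ∧ lt A C x y ∧ z = ZFSet.pair x y}

variable {A A' C C' x y a}

theorem level_mem (hx : x ∈ union A C) : level A C x ∈ levels A C x := by
  obtain ⟨γ, hγ, hx⟩ := hx
  exact csInf_mem ⟨max (posIn C γ) (rankFun (A γ) x), γ, hγ, hx, le_max_left _ _, le_max_right _ _⟩

theorem levels_congr (h : ∀ γ ∈ C, A γ = A' γ) : levels A C x = levels A' C x := by
  ext ξ
  constructor
  · rintro ⟨γ, hγ, H⟩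
    exact ⟨γ, hγ, h γ hγ ▸ H⟩
  · rintro ⟨γ, hγ, H⟩
    exact ⟨γ, hγ, h γ hγ ▸ H⟩

theorem union_congr (h : ∀ γ ∈ C, A γ = A' γ) : union A C = union A' C := by
  ext ξ
  constructor
  · rintro ⟨γ, hγ, H⟩
    exact ⟨γ, hγ, h γ hγ ▸ H⟩
  · rintro ⟨γ, hγ, H⟩
    exact ⟨γ, hγ, h γ hγ ▸ H⟩

theorem segment_congr (h : ∀ γ ∈ C, A γ = A' γ) : segment A C a = segment A' C a := by
  simp only [segment, lt, level, levels_congr h, union_congr h]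

theorem level_le_of_lt (h : lt A C x y) : level A C x ≤ level A C y := by
  rcases Prod.lex_def.1 h with h | h
  · exact h.le
  · exact h.1.le

/-- The `γ` witnessing the level of `x` has position at most that level, so it survives the cut at
`β`; positions below the cut do not change. -/
theorem level_inter_Iio {β : Ordinal.{u}} (hx : x ∈ union A C)
    (h : {γ ∈ C | posIn C γ ≤ level A C x} ⊆ Set.Iio β) :
    x ∈ union A (C ∩ Set.Iio β) ∧ level A (C ∩ Set.Iio β) x = level A C x := by
  obtain ⟨γ, hγ, hxγ, h1, h2⟩ := level_mem hx
  have hβ : γ < β := h ⟨hγ, h1⟩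
  have hu : x ∈ union A (C ∩ Set.Iio β) := ⟨γ, ⟨hγ, hβ⟩, hxγ⟩
  refine ⟨hu, le_antisymm ?_ ?_⟩
  · exact csInf_le' ⟨γ, ⟨hγ, hβ⟩, hxγ, by rwa [posIn_inter_Iio hβ.le], h2⟩
  · obtain ⟨γ, hγ, hxγ, h1, h2⟩ := level_mem hu
    exact csInf_le' ⟨γ, hγ.1, hxγ, by rwa [posIn_inter_Iio hγ.2.le] at h1, h2⟩

theorem union_mono (h : C ⊆ C') : union A C ⊆ union A C' :=
  fun _ ⟨γ, hγ, hx⟩ => ⟨γ, h hγ, hx⟩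

theorem level_le_level_inter_Iio {β : Ordinal.{u}} (hx : x ∈ union A (C ∩ Set.Iio β)) :
    level A C x ≤ level A (C ∩ Set.Iio β) x := by
  obtain ⟨γ, hγ, hxγ, h1, h2⟩ := level_mem hx
  exact csInf_le' ⟨γ, hγ.1, hxγ, by rwa [posIn_inter_Iio hγ.2.le] at h1, h2⟩

/-- Locality of the ordering, which is what makes coherence of the square usable. Everything below
`a` has level at most that of `a`, hence is witnessed before `β`. Conversely, cutting can only raise
levels, so no new predecessors of `a` appear. -/
theorem segment_inter_Iio {β : Ordinal.{u}} (ha : a ∈ union A C)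
    (h : {γ ∈ C | posIn C γ ≤ level A C a} ⊆ Set.Iio β) :
    segment A (C ∩ Set.Iio β) a = segment A C a := by
  have hA := (level_inter_Iio ha h).2
  have key : ∀ x, x ∈ union A C → level A C x ≤ level A C a →
      x ∈ union A (C ∩ Set.Iio β) ∧ level A (C ∩ Set.Iio β) x = level A C x := fun x hx hxa =>
    level_inter_Iio hx fun γ hγ => h ⟨hγ.1, hγ.2.trans hxa⟩
  have key' : ∀ x, x ∈ union A (C ∩ Set.Iio β) → lt A (C ∩ Set.Iio β) x a →
      x ∈ union A C ∧ level A (C ∩ Set.Iio β) x = level A C x := fun x hx hxa => by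
    have hu := union_mono Set.inter_subset_left hx
    refine ⟨hu, (key x hu ?_).2⟩
    exact (level_le_level_inter_Iio hx).trans (hA ▸ level_le_of_lt hxa)
  ext z
  constructor
  · rintro ⟨x, hx, y, hy, hxa, hya, hxy, rfl⟩
    obtain ⟨hx, ex⟩ := key' x hx hxa
    obtain ⟨hy, ey⟩ := key' y hy hya
    simp only [lt, ex, ey, hA] at hxa hya hxy
    exact ⟨x, hx, y, hy, hxa, hya, hxy, rfl⟩
  · rintro ⟨x, hx, y, hy, hxa, hya, hxy, rfl⟩
    obtain ⟨hx, ex⟩ := key x hx (level_le_of_lt hxa)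
    obtain ⟨hy, ey⟩ := key y hy (level_le_of_lt hya)
    refine ⟨x, hx, y, hy, ?_, ?_, ?_, rfl⟩ <;> simpa only [lt, ex, ey, hA]

theorem level_lt (hC : Ordinal.type (fun x y : C => x < y) ≤ ω_ 1) (hA : ∀ γ ∈ C, #(A γ) ≤ ℵ_ 1)
    (hx : x ∈ union A C) : level A C x < ω_ 1 := by
  obtain ⟨γ, hγ, hx⟩ := hx
  have hmem : max (posIn C γ) (rankFun (A γ) x) ∈ levels A C x :=
    ⟨γ, hγ, hx, le_max_left _ _, le_max_right _ _⟩
  exact (csInf_le' hmem).trans_lt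
    (max_lt (posIn_lt hγ hC) (rankFun_lt (hA γ hγ) hx))

theorem countable_level_le (hA : ∀ γ ∈ C, #(A γ) ≤ ℵ_ 1) {ξ : Ordinal.{u + 1}} (hξ : ξ < ω_ 1) :
    {x ∈ union A C | level A C x ≤ ξ}.Countable := by
  refine Set.Countable.mono (s₂ := ⋃ γ ∈ {γ ∈ C | posIn C γ ≤ ξ}, {x ∈ A γ | rankFun (A γ) x ≤ ξ})
    ?_ ((countable_posIn_le C hξ).biUnion fun γ hγ => ?_)
  · rintro x ⟨hx, hξ⟩
    obtain ⟨γ, hγ, hx, h1, h2⟩ := level_mem hx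
    exact Set.mem_biUnion (x := γ) ⟨hγ, h1.trans hξ⟩ ⟨hx, h2.trans hξ⟩
  · exact Set.MapsTo.countable_of_injOn (fun _ h => h.2)
      ((injOn_rankFun (hA γ hγ.1)).mono fun _ h => h.1) (countable_Iic_of_lt_omega_one hξ)

instance isWellOrder_lt : IsWellOrder ZFSet.{u} (lt A C) :=
  have : IsWellOrder (Ordinal.{u + 1} × ZFSet.{u}) (Prod.Lex (· < ·) WellOrderingRel) :=
    inferInstance
  RelEmbedding.isWellOrder (s := Prod.Lex (· < ·) WellOrderingRel)
    ⟨⟨fun x => (level A C x, x), fun _ _ h => congrArg Prod.snd h⟩, Iff.rfl⟩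

instance isWellOrder_lt_subtype (M : Set ZFSet.{u}) :
    IsWellOrder M (fun x y => lt A C x y) :=
  RelEmbedding.isWellOrder (s := lt A C) ⟨⟨Subtype.val, Subtype.val_injective⟩, Iff.rfl⟩

/-- Predecessors of `a` have level at most that of `a`, a countable ordinal, so there are only
countably many; the cardinality of the union gives the other inequality. -/
theorem type_lt (hC : Ordinal.type (fun x y : C => x < y) ≤ ω_ 1)
    (hA : ∀ γ ∈ C, #(A γ) ≤ ℵ_ 1) (hU : #(union A C) = ℵ_ 1) :
    Ordinal.type (fun x y : union A C => lt A C x y) = ω_ 1 := by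
  apply le_antisymm
  · by_contra! hlt
    obtain ⟨a, ha⟩ := Ordinal.typein_surj (fun x y : union A C => lt A C x y) hlt
    have h1 : #{y : union A C // lt A C y a} = ℵ_ 1 := by
      have := congrArg Ordinal.card ha
      rwa [card_typein, card_omega] at this
    have h2 : {y : union A C | lt A C y a}.Countable := by
      have := countable_level_le hA (level_lt hC hA a.2)
      refine Set.MapsTo.countable_of_injOn (f := Subtype.val) (fun y hy => ?_)
        Subtype.val_injective.injOn this
      exact ⟨y.2, level_le_of_lt hy⟩
    have h3 : #{y : union A C // lt A C y a} ≤ ℵ₀ := mk_le_aleph0_iff.2 h2.to_subtype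
    rw [h1, ← aleph_zero, aleph_le_aleph] at h3
    simp at h3
  · rw [← ord_aleph, ord_le, card_type, hU]

end Thread

/-! ### Models with a well-ordering of type `ω₁` -/

theorem exists_forall_rel_of_countable {α : Type u} {r : α → α → Prop} [IsWellOrder α r]
    (hr : Ordinal.type r = ω_ 1) {X : Set α} (hX : X.Countable) : ∃ a, ∀ x ∈ X, r x a := by
  have := hX.to_subtype
  have hlt : (⨆ x : X, Ordinal.typein r x.1) < ω_ 1 :=
    Ordinal.iSup_lt_omega_one fun x => hr ▸ Ordinal.typein_lt_type r x.1
  obtain ⟨a, ha⟩ := Ordinal.typein_surj r (hr ▸ (isSuccLimit_omega 1).succ_lt hlt)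
  refine ⟨a, fun x hx => ?_⟩
  rw [← Ordinal.typein_lt_typein r, ha, Order.lt_succ_iff]
  exact le_ciSup (f := fun x : X => Ordinal.typein r x.1) Ordinal.bddAbove_of_small ⟨x, hx⟩

theorem countable_rel_of_type_eq {α : Type u} {r : α → α → Prop} [IsWellOrder α r]
    (hr : Ordinal.type r = ω_ 1) (a : α) : {x | r x a}.Countable := by
  have h : Ordinal.typein r a < ω_ 1 := hr ▸ Ordinal.typein_lt_type r a
  rw [← ord_aleph, lt_ord, card_typein, ← succ_aleph0, Order.lt_succ_iff] at h
  exact le_aleph0_iff_set_countable.1 h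

theorem orderedGoodModels_subset {χ : Cardinal.{u}} (hχ : χ.IsRegular) :
    OrderedGoodModels χ ⊆ GoodModels χ := by
  rintro M ⟨hM, hc, r, hr, hrt, hseg⟩
  refine ⟨hM, hc, fun X hXM hX => ?_⟩
  rw [lift_aleph0] at hX
  obtain ⟨a, ha⟩ := exists_forall_rel_of_countable hrt (X := {m : M | (m : ZFSet.{u}) ∈ X})
    ((le_aleph0_iff_set_countable.1 hX.le).preimage_of_injOn Subtype.val_injective.injOn)
  obtain ⟨s, hs, hsa⟩ := hseg a
  have hXinf : X.Infinite := Set.infinite_coe_iff.1 (infinite_iff.2 hX.ge)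
  have key : ∀ z, z ∈ ZFSet.sUnion (ZFSet.sUnion s) ↔ ∃ m : M, r m a ∧ m = z := by
    intro z
    constructor
    · intro hz
      simp only [ZFSet.mem_sUnion, hsa] at hz
      obtain ⟨w, ⟨p, ⟨x, y, hx, hy, -, rfl⟩, hw⟩, hz⟩ := hz
      rw [ZFSet.pair, ZFSet.mem_pair] at hw
      rcases hw with rfl | rfl
      · rw [ZFSet.mem_singleton] at hz
        exact ⟨x, hx, hz.symm⟩
      · rw [ZFSet.mem_pair] at hz
        rcases hz with rfl | rfl
        exacts [⟨x, hx, rfl⟩, ⟨y, hy, rfl⟩]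
    · rintro ⟨m, hm, rfl⟩
      -- A predecessor of `a` shows up in `s` only if paired with another one; the infinite set `X`
      -- supplies a partner different from `m`.
      obtain ⟨n, hn, hne⟩ := (hXinf.sdiff (Set.finite_singleton (m : ZFSet.{u}))).nonempty
      have hna := ha ⟨n, hXM hn⟩ hn
      have hmem : ∀ x y : M, r x a → r y a → r x y → ∀ z ∈ ({(x : ZFSet), (y : ZFSet)} : ZFSet),
          z ∈ ZFSet.sUnion (ZFSet.sUnion s) := by
        intro x y hx hy hxy z hz
        refine ZFSet.mem_sUnion.2 ⟨_, ZFSet.mem_sUnion.2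
          ⟨_, (hsa _).2 ⟨x, y, hx, hy, hxy, rfl⟩, ?_⟩, hz⟩
        simp [ZFSet.pair]
      rcases trichotomous_of r m ⟨n, hXM hn⟩ with h | h | h
      · exact hmem _ _ hm hna h _ (by simp)
      · exact absurd (congrArg Subtype.val h).symm hne
      · exact hmem _ _ hna hm h _ (by simp)
  have hcoe : (ZFSet.sUnion (ZFSet.sUnion s) : Set ZFSet.{u}) = Subtype.val '' {x | r x a} := by
    ext z
    exact key z
  have hX' : X ⊆ (ZFSet.sUnion (ZFSet.sUnion s) : Set ZFSet.{u}) := fun x hx =>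
    (key x).2 ⟨⟨x, hXM hx⟩, ha _ hx, rfl⟩
  have hH := hM.subset hs
  refine ⟨ZFSet.sUnion (ZFSet.sUnion s), ?_, ?_, ?_, hX'⟩
  · have hp := HSets.isPairClosed hχ
    exact hM.sUnion_mem hp (hM.sUnion_mem hp hs (HSets.sUnion_mem hH))
      (HSets.sUnion_mem (HSets.sUnion_mem hH))
  · intro z hz
    obtain ⟨m, -, rfl⟩ := (key z).1 hz
    exact m.2
  · rw [← Cardinal.lift_inj.{u, u + 1}, ← ZFSet.cardinalMk_coe_sort, lift_aleph0]
    apply le_antisymm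
    · change #(_ : Set ZFSet.{u}) ≤ _
      rw [hcoe, le_aleph0_iff_set_countable]
      exact (countable_rel_of_type_eq hrt a).image _
    · rw [← hX]
      exact mk_le_mk_of_subset hX'

theorem SetPoset.SEPPlus.sep {P : SetPoset.{u}} (h : P.SEPPlus) : P.SEP := by
  obtain ⟨χ₀, h⟩ := h
  refine ⟨χ₀, fun χ hχ hr X hX hc => ?_⟩
  obtain ⟨M, hM, hXM⟩ := h χ hχ hr X hX hc
  exact ⟨M, ⟨orderedGoodModels_subset hr hM.1, hM.2⟩, hXM⟩

/-! ### Chains of models of length `ω₂` -/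

theorem mk_biUnion_le_of_le {ι α : Type u} {c : Cardinal.{u}} (hc : ℵ₀ ≤ c) {s : Set ι}
    {A : ι → Set α} (hs : #s ≤ c) (hA : ∀ i ∈ s, #(A i) ≤ c) : #(⋃ i ∈ s, A i) ≤ c :=
  (mk_biUnion_le A s).trans <|
    (mul_le_mul' hs (ciSup_le' fun i : s => hA i.1 i.2)).trans (mul_eq_self hc).le

theorem aleph0_le_aleph_one : ℵ₀ ≤ ℵ_ (1 : Ordinal.{u}) := aleph0_le_aleph 1

theorem lift_aleph_one : Cardinal.lift.{u + 1} (ℵ_ (1 : Ordinal.{u})) = ℵ_ 1 := by simp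

theorem lift_aleph_two : Cardinal.lift.{u + 1} (ℵ_ (2 : Ordinal.{u})) = ℵ_ 2 := by simp

theorem aleph_one_lt_aleph_two : ℵ_ (1 : Ordinal.{u}) < ℵ_ 2 := aleph_lt_aleph.2 (by norm_num)

theorem succ_aleph_one : Order.succ (ℵ_ (1 : Ordinal.{u})) = ℵ_ 2 := by
  rw [succ_aleph]
  norm_num [one_add_one_eq_two]

theorem mk_Iio_le_aleph_one {α : Ordinal.{u}} (h : α < ω_ 2) : #(Set.Iio α) ≤ ℵ_ 1 := by
  rw [← ord_aleph, lt_ord, ← succ_aleph_one, Order.lt_succ_iff] at h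
  rw [Cardinal.mk_Iio_ordinal, ← lift_aleph_one]
  exact Cardinal.lift_le.2 h

/-- Transfinite recursion below `ω₂` inside a family of sets. -/
theorem exists_transfinite_choice {β : Type*} {o : Ordinal.{u}} (F : Set (Set β))
    (U : Ordinal.{u} → (Ordinal.{u} → Set β) → Set β)
    (hU : ∀ α A A', (∀ γ < α, A γ = A' γ) → U α A = U α A')
    (hstep : ∀ α < o, ∀ A, (∀ γ < α, A γ ∈ F) → ∃ M ∈ F, U α A ⊆ M) :
    ∃ A : Ordinal.{u} → Set β, ∀ α < o, A α ∈ F ∧ U α A ⊆ A α := by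
  classical
  -- The value ∅ at indices from `α` on is harmless, since by `hU` only the earlier values matter.
  let G : ∀ α : Ordinal.{u}, (∀ γ < α, Set β) → Set β := fun α f =>
    U α fun γ => if h : γ < α then f γ h else ∅
  let A : Ordinal.{u} → Set β := lt_wf.fix fun α f =>
    if h : ∃ M ∈ F, G α f ⊆ M then h.choose else ∅
  have hG : ∀ α, G α (fun γ _ => A γ) = U α A := fun α => hU _ _ _ fun γ hγ => by simp [hγ]
  have hA : ∀ α, A α = if h : ∃ M ∈ F, G α (fun γ _ => A γ) ⊆ M then h.choose else ∅ :=
    fun α => lt_wf.fix_eq _ α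
  refine ⟨A, fun α => ?_⟩
  induction α using WellFoundedLT.induction with
  | _ α ih =>
    intro hα
    have h := hstep α hα A fun γ hγ => (ih γ hγ (hγ.trans hα)).1
    rw [← hG] at h ⊢
    rw [hA, dif_pos h]
    exact h.choose_spec

theorem Thread.union_eq_biUnion (A : Ordinal.{u} → Set ZFSet.{u}) (C : Set Ordinal.{u}) :
    Thread.union A C = ⋃ γ ∈ C, A γ := by
  ext x
  simp [Thread.union]

theorem Thread.mk_segment_le {A : Ordinal.{u} → Set ZFSet.{u}} {C : Set Ordinal.{u}}
    (h : #(Thread.union A C) ≤ ℵ_ 1) (a : ZFSet.{u}) : #(Thread.segment A C a) ≤ ℵ_ 1 := by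
  have : Thread.segment A C a ⊆ Set.range
      fun p : Thread.union A C × Thread.union A C => ZFSet.pair p.1 p.2 := by
    rintro z ⟨x, hx, y, hy, -, -, -, rfl⟩
    exact ⟨(⟨x, hx⟩, ⟨y, hy⟩), rfl⟩
  refine (mk_le_mk_of_subset this).trans (mk_range_le.trans ?_)
  rw [← mul_def]
  exact (mul_le_mul' h h).trans (mul_eq_self aleph0_le_aleph_one).le

/-- An increasing `ω₂`-chain of members of `F`, all of them containing `X`, such that each member
contains its predecessors as elements, and also the initial segments of the ordering of the
union along `C α`. -/
structure IsModelChain (F : Set (Set ZFSet.{u})) (X : Set ZFSet.{u})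
    (C : Ordinal.{u} → Set Ordinal.{u}) (A : Ordinal.{u} → Set ZFSet.{u}) : Prop where
  mem_family : ∀ α < ω_ 2, A α ∈ F
  base_subset : ∀ α < ω_ 2, X ⊆ A α
  mono : ∀ α < ω_ 2, ∀ β < α, A β ⊆ A α
  mem_of_coe_eq : ∀ α < ω_ 2, ∀ β < α, ∀ x : ZFSet.{u}, (x : Set ZFSet.{u}) = A β → x ∈ A α
  segment_mem : ∀ α < ω_ 2, C α ⊆ Set.Iio α → ∀ a ∈ Thread.union A (C α),
    ∃ s ∈ A α, (s : Set ZFSet.{u}) = Thread.segment A (C α) a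

/-- At stage `α` only ℵ₁ many sets are required: there are at most ℵ₁ earlier models, each of size
ℵ₁, and one segment for each element of their union along `C α`. All of these are in `HSets χ`, so
cofinality of `F` provides the next model. -/
theorem exists_isModelChain {χ : Cardinal.{u}} (hχ : χ.IsRegular) (h2 : ℵ_ 2 < χ)
    {F : Set (Set ZFSet.{u})} (hF : IsCofinalFamily F (HSets χ))
    (hFs : ∀ M ∈ F, M ⊆ HSets χ ∧ #M = ℵ_ 1) {X : Set ZFSet.{u}} (hX : X ⊆ HSets χ)
    (hXc : #X = ℵ_ 1) (C : Ordinal.{u} → Set Ordinal.{u}) :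
    ∃ A, IsModelChain F X C A := by
  have hχ1 : ℵ_ 1 < Cardinal.lift.{u + 1} χ := by
    rw [← lift_aleph_one]
    exact Cardinal.lift_lt.2 (aleph_one_lt_aleph_two.trans h2)
  have h01 := aleph0_le_aleph_one.{u + 1}
  -- Here `C` is arbitrary; truncating it makes stage `α` depend on earlier stages only.
  let D : Ordinal.{u} → Set Ordinal.{u} := fun α => {γ ∈ C α | γ < α}
  let U : Ordinal.{u} → (Ordinal.{u} → Set ZFSet.{u}) → Set ZFSet.{u} := fun α A =>
    X ∪ ((⋃ γ ∈ Set.Iio α, A γ) ∪ ((⋃ γ ∈ Set.Iio α, {x : ZFSet.{u} | (x : Set ZFSet.{u}) = A γ}) ∪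
      ⋃ a ∈ Thread.union A (D α), {s : ZFSet.{u} |
        (s : Set ZFSet.{u}) = Thread.segment A (D α) a}))
  have hsing : ∀ T : Set ZFSet.{u}, #{x : ZFSet.{u} | (x : Set ZFSet.{u}) = T} ≤ ℵ_ 1 := by
    intro T
    have : #{x : ZFSet.{u} | (x : Set ZFSet.{u}) = T} ≤ 1 := by
      rw [Cardinal.le_one_iff_subsingleton]
      exact ⟨fun x y => Subtype.ext (SetLike.coe_injective (x.2.trans y.2.symm))⟩
    exact this.trans (one_le_aleph0.trans h01)
  have hun : ∀ α < ω_ 2, ∀ A : Ordinal.{u} → Set ZFSet.{u}, (∀ γ < α, A γ ∈ F) →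
      #(Thread.union A (D α)) ≤ ℵ_ 1 := by
    intro α hα A hA
    rw [Thread.union_eq_biUnion]
    exact mk_biUnion_le_of_le h01
      ((mk_le_mk_of_subset fun γ hγ => hγ.2).trans (mk_Iio_le_aleph_one hα))
      fun γ hγ => (hFs _ (hA γ hγ.2)).2.le
  have hseg : ∀ α < ω_ 2, ∀ A : Ordinal.{u} → Set ZFSet.{u}, (∀ γ < α, A γ ∈ F) →
      ∀ a, Thread.segment A (D α) a ⊆ HSets χ := by
    rintro α hα A hA a _ ⟨x, ⟨γ, hγ, hx⟩, y, ⟨γ', hγ', hy⟩, -, -, -, rfl⟩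
    exact HSets.pair_mem hχ ((hFs _ (hA γ hγ.2)).1 hx) ((hFs _ (hA γ' hγ'.2)).1 hy)
  obtain ⟨A, hA⟩ := exists_transfinite_choice (o := ω_ 2) F U
    (by
      intro α A A' h
      have h1 : ∀ γ ∈ Set.Iio α, A γ = A' γ := h
      have h2 : ∀ γ ∈ D α, A γ = A' γ := fun γ hγ => h γ hγ.2
      have h3 : ∀ a, Thread.segment A (D α) a = Thread.segment A' (D α) a := fun a =>
        Thread.segment_congr h2
      simp only [U, h3, Thread.union_congr h2]
      congr 2
      · exact Set.iUnion₂_congr h1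
      · congr 1
        exact Set.iUnion₂_congr fun γ hγ => by rw [h1 γ hγ])
    (by
      intro α hα A hAF
      have hsub : U α A ⊆ HSets χ := by
        refine Set.union_subset hX (Set.union_subset ?_ (Set.union_subset ?_ ?_))
        · exact Set.iUnion₂_subset fun γ hγ => (hFs _ (hAF γ hγ)).1
        · refine Set.iUnion₂_subset fun γ hγ x (hx : _ = _) => ?_
          refine HSets.mem_of_mk_lt hχ (fun y hy => (hFs _ (hAF γ hγ)).1 (hx ▸ hy)) ?_
          rw [hx, (hFs _ (hAF γ hγ)).2]
          exact hχ1
        · refine Set.iUnion₂_subset fun a ha s (hs : _ = _) => ?_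
          refine HSets.mem_of_mk_lt hχ (fun y hy => hseg α hα A hAF a (hs ▸ hy)) ?_
          rw [hs]
          exact (Thread.mk_segment_le (hun α hα A hAF) a).trans_lt hχ1
      have hcard : #(U α A) ≤ ℵ_ 1 := by
        have hI := mk_Iio_le_aleph_one hα
        refine (mk_union_le _ _).trans (add_le_of_le h01 hXc.le ?_)
        refine (mk_union_le _ _).trans (add_le_of_le h01 ?_ ?_)
        · exact mk_biUnion_le_of_le h01 hI fun γ hγ => (hFs _ (hAF γ hγ)).2.le
        refine (mk_union_le _ _).trans (add_le_of_le h01 ?_ ?_)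
        · exact mk_biUnion_le_of_le h01 hI fun γ hγ => hsing _
        · exact mk_biUnion_le_of_le h01 (hun α hα A hAF) fun γ hγ => hsing _
      exact hF _ hsub (le_antisymm hcard (hXc ▸ mk_le_mk_of_subset Set.subset_union_left)))
  refine ⟨A, fun α hα => (hA α hα).1, fun α hα => Set.subset_union_left.trans (hA α hα).2,
    fun α hα β hβ x hx => (hA α hα).2 (.inr (.inl (Set.mem_biUnion hβ hx))),
    fun α hα β hβ x hx => (hA α hα).2 (.inr (.inr (.inl (Set.mem_biUnion hβ hx)))), ?_⟩
  intro α hα hC a ha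
  have hAF : ∀ γ < α, A γ ∈ F := fun γ hγ => (hA γ (hγ.trans hα)).1
  have hD : D α = C α := Set.sep_eq_self_iff_mem_true.2 fun γ hγ => hC hγ
  obtain ⟨s, -, hs⟩ := HSets.exists_of_mk_lt hχ (hseg α hα A hAF a)
    ((Thread.mk_segment_le (hun α hα A hAF) a).trans_lt hχ1)
  rw [← hD] at ha ⊢
  exact ⟨s, (hA α hα).2 (.inr (.inr (.inr (Set.mem_biUnion ha hs)))), hs⟩

/-! ### Bounds below ω₂, relations coded as sets, and countable covering. -/

theorem exists_bound_lt_omega_two {S : Set Ordinal.{u}} (hS : S ⊆ Set.Iio (ω_ 2))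
    (hc : #S ≤ ℵ_ 1) : ∃ α < ω_ 2, ∀ β ∈ S, β < α := by
  have hcof : #S < (Ordinal.lift.{u + 1} (ω_ (2 : Ordinal.{u}))).cof := by
    rw [← Ordinal.lift_cof, ← ord_aleph, ← succ_aleph_one, (isRegular_succ aleph0_le_aleph_one).cof_ord,
      succ_aleph_one, lift_aleph_two]
    exact hc.trans_lt aleph_one_lt_aleph_two
  have hlt : (⨆ β : S, (β : Ordinal.{u})) < ω_ 2 :=
    Ordinal.lift_iSup_lt_of_lt_cof (by rwa [Cardinal.lift_id'.{u, u + 1}]) fun β => hS β.2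
  have : Small.{u} S := by
    obtain ⟨d, hd⟩ := mem_range_lift_of_le (hc.trans_eq lift_aleph_one.symm)
    obtain ⟨e⟩ := Cardinal.lift_mk_eq'.1 (show Cardinal.lift.{u + 1} #d.out = Cardinal.lift.{u} #S by
      rw [mk_out, Cardinal.lift_id'.{u, u + 1}, hd])
    exact ⟨_, ⟨e.symm⟩⟩
  exact ⟨_, (isSuccLimit_omega 2).succ_lt hlt, fun β hβ => Order.lt_succ_iff.2
    (le_ciSup (f := fun β : S => (β : Ordinal.{u})) Ordinal.bddAbove_of_small ⟨β, hβ⟩)⟩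

theorem HSets.exists_relation {χ : Cardinal.{u}} (hχ : χ.IsRegular) {S T : Set ZFSet.{u}}
    (hS : S ⊆ HSets χ) (hT : T ⊆ HSets χ) (hSc : #S < Cardinal.lift.{u + 1} χ)
    (hTc : #T < Cardinal.lift.{u + 1} χ) (R : ZFSet.{u} → ZFSet.{u} → Prop) :
    ∃ f ∈ HSets χ, ∀ z : ZFSet.{u}, z ∈ f ↔ ∃ x ∈ S, ∃ y ∈ T, R x y ∧ z = ZFSet.pair x y := by
  have hsub : {z : ZFSet.{u} | ∃ x ∈ S, ∃ y ∈ T, R x y ∧ z = ZFSet.pair x y} ⊆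
      Set.range fun p : S × T => ZFSet.pair p.1 p.2 := by
    rintro z ⟨x, hx, y, hy, -, rfl⟩
    exact ⟨(⟨x, hx⟩, ⟨y, hy⟩), rfl⟩
  obtain ⟨f, hf, hfe⟩ := HSets.exists_of_mk_lt hχ
    (T := {z | ∃ x ∈ S, ∃ y ∈ T, R x y ∧ z = ZFSet.pair x y})
    (by
      rintro _ ⟨x, hx, y, hy, -, rfl⟩
      exact HSets.pair_mem hχ (hS hx) (hT hy))
    (by
      refine ((mk_le_mk_of_subset hsub).trans mk_range_le).trans_lt ?_
      rw [← mul_def]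
      exact mul_lt_of_lt hχ.lift.aleph0_le hSc hTc)
  exact ⟨f, hf, fun z => by rw [← SetLike.mem_coe, hfe]; rfl⟩

theorem HSets.exists_pair_mem_iff {χ : Cardinal.{u}} (hχ : χ.IsRegular) {S T : Set ZFSet.{u}}
    (hS : S ⊆ HSets χ) (hT : T ⊆ HSets χ) (hSc : #S < Cardinal.lift.{u + 1} χ)
    (hTc : #T < Cardinal.lift.{u + 1} χ) (R : ZFSet.{u} → ZFSet.{u} → Prop) :
    ∃ f ∈ HSets χ, ∀ x y : ZFSet.{u}, ZFSet.pair x y ∈ f ↔ x ∈ S ∧ y ∈ T ∧ R x y := by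
  obtain ⟨f, hf, h⟩ := HSets.exists_relation hχ hS hT hSc hTc R
  refine ⟨f, hf, fun x y => (h _).trans ⟨?_, fun ⟨hx, hy, hR⟩ => ⟨x, hx, y, hy, hR, rfl⟩⟩⟩
  rintro ⟨x', hx, y', hy, hR, e⟩
  obtain ⟨rfl, rfl⟩ := ZFSet.pair_injective e
  exact ⟨hx, hy, hR⟩

theorem CofinalCovering.exists_countable {M : Set ZFSet.{u}} (h : CofinalCovering ℵ₀ M)
    (hM : ℵ₀ ≤ #M) {T : Set ZFSet.{u}} (hT : T ⊆ M) (hTc : T.Countable) :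
    ∃ Y ∈ M, (Y : Set ZFSet.{u}).Countable ∧ T ⊆ (Y : Set ZFSet.{u}) := by
  obtain ⟨S, hS, hSc⟩ := Cardinal.le_mk_iff_exists_subset.1 hM
  have hc : #(S ∪ T : Set ZFSet.{u}) = ℵ₀ :=
    le_antisymm (le_aleph0_iff_set_countable.2
      ((le_aleph0_iff_set_countable.1 hSc.le).union hTc))
      (hSc ▸ mk_le_mk_of_subset Set.subset_union_left)
  obtain ⟨Y, hY, -, hYc, hsub⟩ := h (S ∪ T) (Set.union_subset hS hT) (by rw [hc, lift_aleph0])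
  refine ⟨Y, hY, ?_, Set.subset_union_right.trans hsub⟩
  rw [← le_aleph0_iff_set_countable]
  change #Y ≤ ℵ₀
  rw [ZFSet.cardinalMk_coe_sort, hYc, lift_aleph0]

namespace SetPoset

/-- Every element of `Q` below (above) `p` is below (above) some element of `Q ∩ B` which is
below (above) `p`. -/
def Dominates (P : SetPoset.{u}) (Q B : Set ZFSet.{u}) (p : ZFSet.{u}) : Prop :=
  (∀ q ∈ Q, P.Le q p → ∃ c ∈ Q, c ∈ B ∧ P.Le c p ∧ P.Le q c) ∧
    ∀ q ∈ Q, P.Le p q → ∃ c ∈ Q, c ∈ B ∧ P.Le p c ∧ P.Le c q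

/-- The models witnessing `SEP(P)`. -/
def sepModels (P : SetPoset.{u}) (χ : Cardinal.{u}) : Set (Set ZFSet.{u}) :=
  {M | M ∈ GoodModels χ ∧ P.SubordSigma (P.trace M)}

end SetPoset

/-! ### The union of an ω₂-chain and the use of the IDP. -/

section Chain

variable {χ : Cardinal.{u}} {P : SetPoset.{u}} {X : Set ZFSet.{u}}
  {C : Ordinal.{u} → Set Ordinal.{u}} {A : Ordinal.{u} → Set ZFSet.{u}} {a : Ordinal.{u} → ZFSet.{u}}

namespace IsModelChain

theorem exists_codes (hA : IsModelChain (P.sepModels χ) X C A) :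
    ∃ a : Ordinal.{u} → ZFSet.{u}, ∀ α < ω_ 2, (a α : Set ZFSet.{u}) = A α := by
  have : ∀ α, ∃ x : ZFSet.{u}, α < ω_ 2 → (x : Set ZFSet.{u}) = A α := by
    intro α
    by_cases hα : α < ω_ 2
    · have := small_of_mk_le_lift ((hA.mem_family α hα).1.2.1.trans lift_aleph_one.symm).le
      obtain ⟨x, hx⟩ := exists_coe_eq (A α)
      exact ⟨x, fun _ => hx⟩
    · exact ⟨∅, fun h => absurd h hα⟩
  choose a ha using this
  exact ⟨a, ha⟩

theorem mono_le (hA : IsModelChain (P.sepModels χ) X C A) {α β : Ordinal.{u}} (hα : α < ω_ 2)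
    (h : β ≤ α) : A β ⊆ A α := by
  rcases h.eq_or_lt with rfl | h
  · exact subset_rfl
  · exact hA.mono α hα β h

/-- Later models contain earlier ones as elements, and foundation excludes the converse. Membership
between codes thus expresses the order of the indices. -/
theorem code_mem_iff (hA : IsModelChain (P.sepModels χ) X C A)
    (ha : ∀ α < ω_ 2, (a α : Set ZFSet.{u}) = A α) {α β : Ordinal.{u}} (hα : α < ω_ 2)
    (hβ : β < ω_ 2) : a β ∈ a α ↔ β < α := by
  have key : ∀ α < ω_ 2, ∀ β < α, a β ∈ a α := fun α hα β h => by
    rw [← SetLike.mem_coe, ha α hα]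
    exact hA.mem_of_coe_eq α hα β h _ (ha β (h.trans hα))
  refine ⟨fun h => ?_, key α hα β⟩
  by_contra! hle
  rcases hle.eq_or_lt with rfl | hlt
  · exact ZFSet.mem_irrefl _ h
  · exact ZFSet.mem_asymm h (key β hβ α hlt)

theorem code_mem (hA : IsModelChain (P.sepModels χ) X C A)
    (ha : ∀ α < ω_ 2, (a α : Set ZFSet.{u}) = A α) {α β : Ordinal.{u}} (hα : α < ω_ 2)
    (h : β < α) : a β ∈ A α :=
  hA.mem_of_coe_eq α hα β h _ (ha β (h.trans hα))

theorem injOn_code (hA : IsModelChain (P.sepModels χ) X C A)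
    (ha : ∀ α < ω_ 2, (a α : Set ZFSet.{u}) = A α) : (Set.Iio (ω_ 2)).InjOn a := by
  intro α hα β hβ h
  by_contra hne
  rcases lt_or_gt_of_ne hne with hlt | hlt
  · exact ZFSet.mem_irrefl _ (h ▸ (hA.code_mem_iff ha hβ hα).2 hlt)
  · exact ZFSet.mem_irrefl _ (h ▸ (hA.code_mem_iff ha hα hβ).2 hlt)

theorem isElemSubmodel_union (hA : IsModelChain (P.sepModels χ) X C A) {D : Set Ordinal.{u}}
    (hD : D ⊆ Set.Iio (ω_ 2)) (hne : D.Nonempty) :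
    IsElemSubmodel (Thread.union A D) (HSets χ) := by
  have : Thread.union A D = ⋃₀ (A '' D) := by
    rw [Thread.union_eq_biUnion, Set.sUnion_image]
  rw [this]
  refine IsElemSubmodel.sUnion (hne.image A) ?_ ?_
  · rintro _ ⟨α, hα, rfl⟩ _ ⟨β, hβ, rfl⟩
    rcases le_total α β with h | h
    · exact ⟨A β, ⟨β, hβ, rfl⟩, hA.mono_le (hD hβ) h, subset_rfl⟩
    · exact ⟨A α, ⟨α, hα, rfl⟩, subset_rfl, hA.mono_le (hD hα) h⟩
  · rintro _ ⟨α, hα, rfl⟩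
    exact (hA.mem_family α (hD hα)).1.1

theorem mk_union_omega_two (hA : IsModelChain (P.sepModels χ) X C A) :
    #(Thread.union A (Set.Iio (ω_ 2))) = ℵ_ 2 := by
  have hI : #(Set.Iio (ω_ (2 : Ordinal.{u}))) = ℵ_ 2 := by
    rw [Cardinal.mk_Iio_ordinal, card_omega, lift_aleph_two]
  apply le_antisymm
  · rw [Thread.union_eq_biUnion]
    exact mk_biUnion_le_of_le (aleph0_le_aleph 2) hI.le fun α hα =>
      (hA.mem_family α hα).1.2.1.le.trans aleph_one_lt_aleph_two.le
  · obtain ⟨a, ha⟩ := hA.exists_codes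
    rw [← hI, ← mk_image_eq_of_injOn _ _ (hA.injOn_code ha)]
    refine mk_le_mk_of_subset ?_
    rintro _ ⟨α, hα, rfl⟩
    have hs : Order.succ α < ω_ 2 := (isSuccLimit_omega 2).succ_lt hα
    exact ⟨_, hs, hA.code_mem ha hs (Order.lt_succ α)⟩

theorem exists_subset (hA : IsModelChain (P.sepModels χ) X C A) {Y : Set ZFSet.{u}}
    (hY : Y ⊆ Thread.union A (Set.Iio (ω_ 2))) (hc : #Y ≤ ℵ_ 1) : ∃ α < ω_ 2, Y ⊆ A α := by
  choose! f hf hfY using hY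
  obtain ⟨α, hα, h⟩ := exists_bound_lt_omega_two (S := f '' Y)
    (by rintro _ ⟨x, hx, rfl⟩; exact hf hx) (mk_image_le.trans hc)
  exact ⟨α, hα, fun x hx => hA.mono α hα _ (h _ ⟨x, hx, rfl⟩) (hfY hx)⟩

theorem cofinalCovering_union (hA : IsModelChain (P.sepModels χ) X C A) :
    CofinalCovering (ℵ_ 1) (Thread.union A (Set.Iio (ω_ 2))) := by
  obtain ⟨a, ha⟩ := hA.exists_codes
  intro Y hY hc
  obtain ⟨α, hα, hYα⟩ := hA.exists_subset hY (hc.trans lift_aleph_one).le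
  have hs : Order.succ α < ω_ 2 := (isSuccLimit_omega 2).succ_lt hα
  refine ⟨a α, ⟨_, hs, hA.code_mem ha hs (Order.lt_succ α)⟩, ?_, ?_, ?_⟩
  · rw [ha α hα]
    exact fun x hx => ⟨α, hα, hx⟩
  · rw [← Cardinal.lift_inj.{u, u + 1}, ← ZFSet.cardinalMk_coe_sort, lift_aleph_one]
    change #(a α : Set ZFSet.{u}) = _
    rw [ha α hα]
    exact (hA.mem_family α hα).1.2.1
  · rwa [ha α hα]

/-- The cofinal and coinitial sets have size at most ℵ₁, so regularity of ω₂ puts both inside one `A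
α`. -/
theorem exists_dominates (hA : IsModelChain (P.sepModels χ) X C A)
    (hP : P.SubordLt (ℵ_ 2) (P.trace (Thread.union A (Set.Iio (ω_ 2))))) {p : ZFSet.{u}}
    (hp : p ∈ P.carrier) :
    ∃ α < ω_ 2, P.Dominates (P.trace (Thread.union A (Set.Iio (ω_ 2)))) (A α) p := by
  obtain ⟨⟨D, hD, hDc, hDcof⟩, ⟨E, hE, hEc, hEcof⟩⟩ := hP p hp
  rw [lift_aleph_two, ← succ_aleph_one, Order.lt_succ_iff] at hDc hEc
  obtain ⟨α, hα, h⟩ := hA.exists_subset (Y := D ∪ E)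
    (Set.union_subset (fun x hx => (hD hx).1.2) (fun x hx => (hE hx).1.2))
    ((mk_union_le _ _).trans (add_le_of_le aleph0_le_aleph_one hDc hEc))
  refine ⟨α, hα, fun q hq hqp => ?_, fun q hq hqp => ?_⟩
  · obtain ⟨c, hc, hqc⟩ := hDcof q hq hqp
    exact ⟨c, (hD hc).1, h (.inl hc), (hD hc).2, hqc⟩
  · obtain ⟨c, hc, hqc⟩ := hEcof q hq hqp
    exact ⟨c, (hE hc).1, h (.inr hc), (hE hc).2, hqc⟩

end IsModelChain

end Chain

/-! ### Reflecting the chain in a single SEP model. -/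

section Chain

variable {χ : Cardinal.{u}} {P : SetPoset.{u}} {X : Set ZFSet.{u}}
  {C : Ordinal.{u} → Set Ordinal.{u}} {A : Ordinal.{u} → Set ZFSet.{u}} {a : Ordinal.{u} → ZFSet.{u}}

/-- The closure properties of a model `M` that knows the chain `A`, coded by `a`. -/
structure IsReflecting (P : SetPoset.{u}) (A : Ordinal.{u} → Set ZFSet.{u})
    (a : Ordinal.{u} → ZFSet.{u}) (M : Set ZFSet.{u}) : Prop where
  subset_of_code_mem : ∀ α < ω_ 2, a α ∈ M → A α ⊆ M
  exists_code_mem : ∀ x ∈ M, x ∈ Thread.union A (Set.Iio (ω_ 2)) → ∃ α < ω_ 2, a α ∈ M ∧ x ∈ A α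
  exists_dominates : ∀ p ∈ M, p ∈ P.carrier →
    ∃ α < ω_ 2, a α ∈ M ∧ P.Dominates (P.trace (Thread.union A (Set.Iio (ω_ 2)))) (A α) p
  exists_bound : ∀ Y ∈ M, (∃ α < ω_ 2, ∀ γ < ω_ 2, a γ ∈ Y → γ < α) →
    ∃ α < ω_ 2, a α ∈ M ∧ ∀ γ < ω_ 2, a γ ∈ Y → γ < α

theorem exists_image_eq_of_mk_le {α β : Type u} {S : Set α} {T : Set β} (hT : T.Nonempty)
    (h : #T ≤ #S) : ∃ f : α → β, f '' S = T := by
  have := hT.to_subtype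
  obtain ⟨⟨f, hf⟩⟩ := h
  obtain ⟨t, ht⟩ := hT
  classical
  refine ⟨fun x => if hx : x ∈ S then (Function.invFun f ⟨x, hx⟩ : T) else t, ?_⟩
  ext y
  constructor
  · rintro ⟨x, hx, rfl⟩
    simp [hx]
  · intro hy
    refine ⟨f ⟨y, hy⟩, (f ⟨y, hy⟩).2, ?_⟩
    simp [Function.leftInverse_invFun hf _]

/-- It suffices that `M` contain four sets: the set of codes, a choice of enumerations, the
membership relation, and the domination relation. All enumerations are indexed by the same set `X ⊆
M`, so a member of the chain whose code is in `M` is a subset of `M`. -/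
theorem IsModelChain.exists_isReflecting (hχ : χ.IsRegular) (h2 : ℵ_ 2 < χ)
    (hX : X ⊆ HSets χ) (hXc : #X = ℵ_ 1) (hF : IsCofinalFamily (P.sepModels χ) (HSets χ))
    (hA : IsModelChain (P.sepModels χ) X C A) (ha : ∀ α < ω_ 2, (a α : Set ZFSet.{u}) = A α)
    (hcar : P.carrier ∈ HSets χ)
    (hdom : ∀ p ∈ P.carrier, ∃ α < ω_ 2,
      P.Dominates (P.trace (Thread.union A (Set.Iio (ω_ 2)))) (A α) p) :
    ∃ M ∈ P.sepModels χ, X ⊆ M ∧ IsReflecting P A a M := by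
  have hχ2 : ℵ_ 2 < Cardinal.lift.{u + 1} χ := by
    rw [← lift_aleph_two]
    exact Cardinal.lift_lt.2 h2
  have hχ1 : ℵ_ 1 < Cardinal.lift.{u + 1} χ := aleph_one_lt_aleph_two.trans hχ2
  have hAH : ∀ α < ω_ 2, A α ⊆ HSets χ := fun α hα => (hA.mem_family α hα).1.1.subset
  have hAc : ∀ α < ω_ 2, #(A α) = ℵ_ 1 := fun α hα => (hA.mem_family α hα).1.2.1
  let N := Thread.union A (Set.Iio (ω_ 2))
  have hNH : N ⊆ HSets χ := fun x ⟨α, hα, hx⟩ => hAH α hα hx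
  have hNc : #N < Cardinal.lift.{u + 1} χ := hA.mk_union_omega_two.trans_lt hχ2
  have hIc : #(Set.Iio (ω_ (2 : Ordinal.{u}))) < Cardinal.lift.{u + 1} χ := by
    rwa [Cardinal.mk_Iio_ordinal, card_omega, lift_aleph_two]
  -- the set of all members of the chain
  obtain ⟨𝒜, h𝒜H, h𝒜⟩ := HSets.exists_of_mk_lt hχ (T := a '' Set.Iio (ω_ 2))
    (by
      rintro _ ⟨α, hα, rfl⟩
      refine HSets.mem_of_mk_lt hχ (fun y hy => hAH α hα (ha α hα ▸ hy)) ?_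
      rw [ha α hα, hAc α hα]
      exact hχ1) (mk_image_le.trans_lt hIc)
  have h𝒜c : #(𝒜 : Set ZFSet.{u}) < Cardinal.lift.{u + 1} χ := HSets.mk_lt h𝒜H
  have h𝒜s : (𝒜 : Set ZFSet.{u}) ⊆ HSets χ := fun x hx => HSets.mem_of_mem h𝒜H hx
  have mem𝒜 : ∀ x, x ∈ 𝒜 ↔ ∃ α < ω_ 2, a α = x := fun x => by
    rw [← SetLike.mem_coe, h𝒜]
    rfl
  -- the enumerations of the members of the chain
  have hg : ∀ α, ∃ g : ZFSet.{u} → ZFSet.{u}, α < ω_ 2 → g '' X = A α := by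
    intro α
    by_cases hα : α < ω_ 2
    · obtain ⟨g, hg⟩ := exists_image_eq_of_mk_le (S := X) (T := A α)
        (by
          rw [← Set.nonempty_coe_sort, ← mk_ne_zero_iff, hAc α hα]
          exact (aleph_pos 1).ne') (by rw [hXc, hAc α hα])
      exact ⟨g, fun _ => hg⟩
    · exact ⟨id, fun h => absurd h hα⟩
  choose g hg using hg
  have he : ∀ α, ∃ e : ZFSet.{u}, α < ω_ 2 → e ∈ HSets χ ∧ ∀ x y : ZFSet.{u},
      ZFSet.pair x y ∈ e ↔ x ∈ X ∧ y ∈ A α ∧ g α x = y := by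
    intro α
    by_cases hα : α < ω_ 2
    · obtain ⟨e, heH, he⟩ := HSets.exists_pair_mem_iff hχ hX (hAH α hα) (hXc.trans_lt hχ1)
        ((hAc α hα).trans_lt hχ1) (fun x y => g α x = y)
      exact ⟨e, fun _ => ⟨heH, he⟩⟩
    · exact ⟨∅, fun h => absurd h hα⟩
  choose e he using he
  obtain ⟨E, hEH, hE⟩ := HSets.exists_pair_mem_iff hχ h𝒜s (T := e '' Set.Iio (ω_ 2))
    (by
      rintro _ ⟨α, hα, rfl⟩
      exact (he α hα).1) h𝒜c (mk_image_le.trans_lt hIc)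
    (fun x y => ∃ α < ω_ 2, a α = x ∧ e α = y)
  -- the membership relation between `N` and the chain
  obtain ⟨f, hfH, hf⟩ := HSets.exists_pair_mem_iff hχ hNH h𝒜s hNc h𝒜c (fun x y => x ∈ y)
  -- the domination relation
  obtain ⟨G, hGH, hG⟩ := HSets.exists_pair_mem_iff hχ (S := (P.carrier : Set ZFSet.{u}))
    (fun x hx => HSets.mem_of_mem hcar hx) h𝒜s (HSets.mk_lt hcar) h𝒜c
    (fun p y => P.Dominates (P.trace N) (y : Set ZFSet.{u}) p)
  have hfin : #({𝒜, E, f, G} : Set ZFSet.{u}) ≤ ℵ_ 1 :=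
    ((Cardinal.lt_aleph0_iff_set_finite.2 (Set.toFinite _)).le).trans aleph0_le_aleph_one
  obtain ⟨M, hM, hXM⟩ := hF (X ∪ {𝒜, E, f, G})
    (Set.union_subset hX (by
      rintro x (rfl | rfl | rfl | rfl) <;> assumption))
    (le_antisymm ((mk_union_le _ _).trans (add_le_of_le aleph0_le_aleph_one hXc.le hfin))
      (hXc ▸ mk_le_mk_of_subset Set.subset_union_left))
  have h𝒜M : 𝒜 ∈ M := hXM (by simp)
  have hEM : E ∈ M := hXM (by simp)
  have hfM : f ∈ M := hXM (by simp)
  have hGM : G ∈ M := hXM (by simp)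
  have hXM' : X ⊆ M := Set.subset_union_left.trans hXM
  have hel := hM.1.1
  have hp := HSets.isPairClosed hχ
  refine ⟨M, hM, hXM', ⟨?_, ?_, ?_, ?_⟩⟩
  · intro α hα haM y hy
    obtain ⟨x, hx, rfl⟩ := (hg α hα).symm ▸ hy
    obtain ⟨e', he'M, he'⟩ := hel.exists_pair_mem hp hEM haM (y := e α)
      ((hE _ _).2 ⟨(mem𝒜 _).2 ⟨α, hα, rfl⟩, ⟨α, hα, rfl⟩, α, hα, rfl, rfl⟩)
    obtain ⟨-, -, α', hα', haa, rfl⟩ := (hE _ _).1 he'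
    obtain rfl := hA.injOn_code ha hα' hα haa
    obtain ⟨y', hy'M, hy'⟩ := hel.exists_pair_mem hp he'M (hXM' hx) (y := g α' x)
      (((he α' hα').2 _ _).2 ⟨hx, hy, rfl⟩)
    obtain ⟨-, -, rfl⟩ := ((he α' hα').2 _ _).1 hy'
    exact hy'M
  · rintro x hxM ⟨α, hα, hx⟩
    obtain ⟨y, hyM, hy⟩ := hel.exists_pair_mem hp hfM hxM (y := a α)
      ((hf _ _).2 ⟨⟨α, hα, hx⟩, (mem𝒜 _).2 ⟨α, hα, rfl⟩, by
        rwa [← SetLike.mem_coe, ha α hα]⟩)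
    obtain ⟨-, hy𝒜, hxy⟩ := (hf _ _).1 hy
    obtain ⟨β, hβ, rfl⟩ := (mem𝒜 _).1 hy𝒜
    exact ⟨β, hβ, hyM, by rwa [← SetLike.mem_coe, ha β hβ] at hxy⟩
  · intro p hpM hpc
    obtain ⟨α, hα, hd⟩ := hdom p hpc
    obtain ⟨y, hyM, hy⟩ := hel.exists_pair_mem hp hGM hpM (y := a α)
      ((hG _ _).2 ⟨hpc, (mem𝒜 _).2 ⟨α, hα, rfl⟩, by rwa [ha α hα]⟩)
    obtain ⟨-, hy𝒜, hxy⟩ := (hG _ _).1 hy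
    obtain ⟨β, hβ, rfl⟩ := (mem𝒜 _).1 hy𝒜
    exact ⟨β, hβ, hyM, by rwa [ha β hβ] at hxy⟩
  · rintro Y hY ⟨α, hα, hb⟩
    -- A bound on indices becomes a statement about ∈ between codes, which elementarity can reflect.
    obtain ⟨b, hbM, hb𝒜, hbY⟩ := hel.exists_bound hp h𝒜M hY ((mem𝒜 _).2 ⟨α, hα, rfl⟩)
      (by
        intro b hbY hb𝒜
        obtain ⟨γ, hγ, rfl⟩ := (mem𝒜 _).1 hb𝒜
        exact (hA.code_mem_iff ha hα hγ).2 (hb γ hγ hbY))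
    obtain ⟨β, hβ, rfl⟩ := (mem𝒜 _).1 hb𝒜
    exact ⟨β, hβ, hbM, fun γ hγ hγY =>
      (hA.code_mem_iff ha hβ hγ).1 (hbY _ hγY ((mem𝒜 _).2 ⟨γ, hγ, rfl⟩))⟩

/-- `δ` is a limit ordinal of uncountable cofinality below `ω₂`, and it is the height of the
chain `A` in `M`. -/
structure IsHeight (A : Ordinal.{u} → Set ZFSet.{u}) (a : Ordinal.{u} → ZFSet.{u})
    (M : Set ZFSet.{u}) (δ : Ordinal.{u}) : Prop where
  lt : δ < ω_ 2
  isSuccLimit : Order.IsSuccLimit δ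
  code_mem_iff : ∀ α < ω_ 2, a α ∈ M ↔ α < δ
  union_eq : Thread.union A (Set.Iio δ) = Thread.union A (Set.Iio (ω_ 2)) ∩ M
  exists_bound : ∀ S ⊆ Set.Iio δ, S.Countable → ∃ β < δ, ∀ γ ∈ S, γ < β

theorem IsReflecting.exists_isHeight (hXc : #X = ℵ_ 1)
    (hA : IsModelChain (P.sepModels χ) X C A) (ha : ∀ α < ω_ 2, (a α : Set ZFSet.{u}) = A α)
    {M : Set ZFSet.{u}} (hM : M ∈ P.sepModels χ) (hXM : X ⊆ M) (hR : IsReflecting P A a M) :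
    ∃ δ, IsHeight A a M δ := by
  have hMc : #M = ℵ_ 1 := hM.1.2.1
  have hex : ∃ α, α < ω_ 2 ∧ a α ∉ M := by
    by_contra! h
    have h1 : #(a '' Set.Iio (ω_ 2)) ≤ #M := mk_le_mk_of_subset (by
      rintro _ ⟨α, hα, rfl⟩
      exact h α hα)
    rw [mk_image_eq_of_injOn _ _ (hA.injOn_code ha), hMc, Cardinal.mk_Iio_ordinal, card_omega,
      lift_aleph_two] at h1
    exact h1.not_gt aleph_one_lt_aleph_two
  let δ : Ordinal.{u} := sInf {α | α < ω_ 2 ∧ a α ∉ M}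
  obtain ⟨hδ, hδM⟩ : δ < ω_ 2 ∧ a δ ∉ M := csInf_mem (s := {α | α < ω_ 2 ∧ a α ∉ M}) hex
  have hiff : ∀ α < ω_ 2, a α ∈ M ↔ α < δ := by
    intro α hα
    constructor
    · intro h
      by_contra! hle
      rcases hle.eq_or_lt with heq | hlt
      · exact hδM (heq ▸ h)
      · exact hδM (hR.subset_of_code_mem α hα h (hA.code_mem ha hα hlt))
    · intro h
      by_contra hn
      exact (csInf_le' (s := {α | α < ω_ 2 ∧ a α ∉ M}) ⟨hα, hn⟩).not_gt h
  have h0 : (0 : Ordinal.{u}) < ω_ 2 := omega_pos 2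
  have hpos : 0 < δ := by
    have : X.Nonempty := by
      rw [← Set.nonempty_coe_sort, ← mk_ne_zero_iff, hXc]
      exact (aleph_pos 1).ne'
    obtain ⟨x, hx⟩ := this
    -- Any element of `X` lies both in `M` and in the union, which forces some code into `M`.
    obtain ⟨α, hα, haM, -⟩ := hR.exists_code_mem x (hXM hx) ⟨0, h0, hA.base_subset 0 h0 hx⟩
    exact (zero_le : (0 : Ordinal.{u}) ≤ α).trans_lt ((hiff α hα).1 haM)
  have hlim : Order.IsSuccLimit δ := by
    rw [Ordinal.isSuccLimit_iff]
    refine ⟨hpos.ne', Order.isSuccPrelimit_of_succ_lt fun α hα => ?_⟩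
    have hα2 := hα.trans hδ
    have hs := (isSuccLimit_omega 2).succ_lt hα2
    -- The code `a α` is itself an element of the union, and a model containing it has index above
    -- `α`.
    obtain ⟨β, hβ, hβM, hαβ⟩ := hR.exists_code_mem (a α) ((hiff α hα2).2 hα)
      ⟨_, hs, hA.code_mem ha hs (Order.lt_succ α)⟩
    rw [← ha β hβ, SetLike.mem_coe, hA.code_mem_iff ha hβ hα2] at hαβ
    exact (Order.succ_le_of_lt hαβ).trans_lt ((hiff β hβ).1 hβM)
  refine ⟨δ, hδ, hlim, hiff, ?_, ?_⟩
  · ext x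
    constructor
    · rintro ⟨α, hα, hx⟩
      have hα2 : α < ω_ 2 := lt_trans hα hδ
      exact ⟨⟨α, hα2, hx⟩, hR.subset_of_code_mem α hα2 ((hiff α hα2).2 hα) hx⟩
    · rintro ⟨hxN, hxM⟩
      obtain ⟨α, hα, haM, hx⟩ := hR.exists_code_mem x hxM hxN
      exact ⟨α, (hiff α hα).1 haM, hx⟩
  · intro S hS hSc
    -- Uncountable cofinality: the codes of `S` are covered by a countable `Y ∈ M`. The indices
    -- coded in `Y` are bounded below ω₂, and the bound reflects to one with code in `M`.
    obtain ⟨Y, hY, hYc, hSY⟩ := hM.1.2.2.exists_countable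
      (hMc ▸ aleph0_le_aleph_one) (T := a '' S)
      (by
        rintro _ ⟨γ, hγ, rfl⟩
        exact (hiff γ (lt_trans (hS hγ) hδ)).2 (hS hγ)) (hSc.image a)
    have hb : ∃ α < ω_ 2, ∀ γ < ω_ 2, a γ ∈ Y → γ < α := by
      obtain ⟨α, hα, h⟩ := exists_bound_lt_omega_two (S := {γ | γ < ω_ 2 ∧ a γ ∈ Y})
        (fun γ hγ => hγ.1)
        ((le_aleph0_iff_set_countable.2 (Set.MapsTo.countable_of_injOn (f := a)
          (fun γ hγ => hγ.2) ((hA.injOn_code ha).mono fun γ hγ => hγ.1) hYc)).trans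
          aleph0_le_aleph_one)
      exact ⟨α, hα, fun γ hγ hγY => h γ ⟨hγ, hγY⟩⟩
    obtain ⟨β, hβ, hβM, h⟩ := hR.exists_bound Y hY hb
    exact ⟨β, (hiff β hβ).1 hβM, fun γ hγ => h γ (lt_trans (hS hγ) hδ) (hSY ⟨γ, hγ, rfl⟩)⟩

/-- For q ≤ p, interpolate q ≤ b ≤ p with b from the countable set for P ∩ M, then q ≤ c ≤ b with c
in the model dominating for b, then c ≤ d ≤ b with d from the countable set for that model. Its code
is in `M`, so d stays in the union below `δ`. The upper side is dual. -/
theorem IsReflecting.subordSigma (hA : IsModelChain (P.sepModels χ) X C A)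
    {M : Set ZFSet.{u}} (hM : M ∈ P.sepModels χ) (hR : IsReflecting P A a M)
    {δ : Ordinal.{u}} (hδ : IsHeight A a M δ) :
    P.SubordSigma (P.trace (Thread.union A (Set.Iio δ))) := by
  have h1 : ∀ S : Set ZFSet.{u}, #S < Cardinal.lift.{u + 1} (ℵ_ (1 : Ordinal.{u})) ↔
      S.Countable := by
    intro S
    rw [lift_aleph_one, ← succ_aleph0, Order.lt_succ_iff, le_aleph0_iff_set_countable]
  intro p hp
  simp only [h1]
  have hN : ∀ x ∈ Thread.union A (Set.Iio δ), x ∈ Thread.union A (Set.Iio (ω_ 2)) ∧ x ∈ M :=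
    fun x hx => by rwa [hδ.union_eq] at hx
  obtain ⟨⟨B, hB, hBc, hBcof⟩, ⟨B', hB', hBc', hBcof'⟩⟩ := hM.2 p hp
  rw [h1] at hBc hBc'
  choose! f hf hfM hfd using hR.exists_dominates
  have hsub : ∀ b, b ∈ M → b ∈ P.carrier → A (f b) ⊆ Thread.union A (Set.Iio δ) :=
    fun b hbM hbP x hx => ⟨f b, (hδ.code_mem_iff _ (hf b hbM hbP)).1 (hfM b hbM hbP), hx⟩
  have hS : ∀ b, b ∈ M → b ∈ P.carrier → P.SubordSigma (P.trace (A (f b))) :=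
    fun b hbM hbP => (hA.mem_family _ (hf b hbM hbP)).2
  have hS1 : ∀ b, b ∈ M → b ∈ P.carrier → _ := fun b hbM hbP => (hS b hbM hbP b hbP).1
  have hS2 : ∀ b, b ∈ M → b ∈ P.carrier → _ := fun b hbM hbP => (hS b hbM hbP b hbP).2
  choose! D hD hDc hDcof using hS1
  choose! E hE hEc hEcof using hS2
  simp only [h1] at hDc hEc
  refine ⟨⟨⋃ b ∈ B, D b, ?_, hBc.biUnion fun b hb => ?_, ?_⟩,
    ⟨⋃ b ∈ B', E b, ?_, hBc'.biUnion fun b hb => ?_, ?_⟩⟩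
  · refine Set.iUnion₂_subset fun b hb x hx => ?_
    obtain ⟨⟨hbP, hbM⟩, hbp⟩ := hB hb
    obtain ⟨⟨hxP, hxA⟩, hxb⟩ := hD b hbM hbP hx
    exact ⟨⟨hxP, hsub b hbM hbP hxA⟩, P.trans _ _ _ hxb hbp⟩
  · exact hDc b (hB hb).1.2 (hB hb).1.1
  · rintro q ⟨hqP, hqU⟩ hqp
    obtain ⟨hqN, hqM⟩ := hN q hqU
    obtain ⟨b, hb, hqb⟩ := hBcof q ⟨hqP, hqM⟩ hqp
    obtain ⟨⟨hbP, hbM⟩, hbp⟩ := hB hb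
    obtain ⟨c, hc, hcA, hcb, hqc⟩ := (hfd b hbM hbP).1 q ⟨hqP, hqN⟩ hqb
    obtain ⟨d, hd, hcd⟩ := hDcof b hbM hbP c ⟨hc.1, hcA⟩ hcb
    exact ⟨d, Set.mem_biUnion hb hd, P.trans _ _ _ hqc hcd⟩
  · refine Set.iUnion₂_subset fun b hb x hx => ?_
    obtain ⟨⟨hbP, hbM⟩, hbp⟩ := hB' hb
    obtain ⟨⟨hxP, hxA⟩, hxb⟩ := hE b hbM hbP hx
    exact ⟨⟨hxP, hsub b hbM hbP hxA⟩, P.trans _ _ _ hbp hxb⟩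
  · exact hEc b (hB' hb).1.2 (hB' hb).1.1
  · rintro q ⟨hqP, hqU⟩ hqp
    obtain ⟨hqN, hqM⟩ := hN q hqU
    obtain ⟨b, hb, hqb⟩ := hBcof' q ⟨hqP, hqM⟩ hqp
    obtain ⟨⟨hbP, hbM⟩, hbp⟩ := hB' hb
    obtain ⟨c, hc, hcA, hcb, hqc⟩ := (hfd b hbM hbP).2 q ⟨hqP, hqN⟩ hqb
    obtain ⟨d, hd, hcd⟩ := hEcof b hbM hbP c ⟨hc.1, hcA⟩ hcb
    exact ⟨d, Set.mem_biUnion hb hd, P.trans _ _ _ hcd hqc⟩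

end Chain

/-- Above every countable subset of an ordinal of uncountable cofinality, a club has a limit
point. -/
theorem IsClubIn.exists_isLimitPointOf {C : Set Ordinal.{u}} {δ : Ordinal.{u}}
    (hC : IsClubIn C δ) (hδ : ∀ S ⊆ Set.Iio δ, S.Countable → ∃ β < δ, ∀ γ ∈ S, γ < β)
    {S : Set Ordinal.{u}} (hS : S ⊆ Set.Iio δ) (hSc : S.Countable) :
    ∃ β < δ, IsLimitPointOf β C ∧ S ⊆ Set.Iio β := by
  obtain ⟨γ₀, hγ₀, hSγ⟩ := hδ S hS hSc
  choose! next hnext hlt using hC.unbounded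
  let c : ℕ → Ordinal.{u} := fun n => next^[n] γ₀
  have hs : ∀ n, c (n + 1) = next (c n) := fun n => Function.iterate_succ_apply' next n γ₀
  have hc : ∀ n, c n < δ := by
    intro n
    induction n with
    | zero => exact hγ₀
    | succ n ih =>
      rw [hs]
      exact hC.subset _ (hnext _ ih)
  have hcC : ∀ n, c (n + 1) ∈ C := fun n => hs n ▸ hnext _ (hc n)
  have hcl : ∀ n, c n < c (n + 1) := fun n => hs n ▸ hlt _ (hc n)
  have hle : ∀ n, c n ≤ ⨆ n, c n := fun n => le_ciSup Ordinal.bddAbove_of_small n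
  have hlt' : ∀ n, c n < ⨆ n, c n := fun n => (hcl n).trans_le (hle _)
  obtain ⟨β', hβ', hb⟩ := hδ (Set.range c) (by rintro _ ⟨n, rfl⟩; exact hc n)
    (Set.countable_range c)
  refine ⟨⨆ n, c n, (ciSup_le' fun n => (hb _ ⟨n, rfl⟩).le).trans_lt hβ', ⟨?_, ?_⟩, ?_⟩
  · exact ((zero_le : (0 : Ordinal.{u}) ≤ c 0).trans_lt (hlt' 0)).ne'
  · intro γ hγ
    obtain ⟨n, hn⟩ := exists_lt_of_lt_ciSup hγ
    exact ⟨c (n + 1), hcC n, hn.trans (hcl n), hlt' _⟩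
  · exact fun γ hγ => (hSγ γ hγ).trans (hlt' 0)

/-! ### The well-ordering of the union along the club at δ. -/

section Chain

variable {χ : Cardinal.{u}} {P : SetPoset.{u}} {X : Set ZFSet.{u}}
  {C : Ordinal.{u} → Set Ordinal.{u}} {A : Ordinal.{u} → Set ZFSet.{u}} {a : Ordinal.{u} → ZFSet.{u}}

theorem IsHeight.mem_orderedGoodModels
    (hC : ∀ α : Ordinal.{u}, α < ω_ 2 → Order.IsSuccLimit α →
      IsClubIn (C α) α ∧ Ordinal.type (fun x y : C α => x < y) ≤ ω_ 1 ∧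
      ∀ β < α, IsLimitPointOf β (C α) → C β = C α ∩ Set.Iio β)
    (hA : IsModelChain (P.sepModels χ) X C A) {M : Set ZFSet.{u}} {δ : Ordinal.{u}}
    (hδ : IsHeight A a M δ) : Thread.union A (Set.Iio δ) ∈ OrderedGoodModels χ := by
  obtain ⟨hclub, htype, hcoh⟩ := hC δ hδ.lt hδ.isSuccLimit
  have hlt2 : ∀ α < δ, α < ω_ 2 := fun α hα => hα.trans hδ.lt
  have hAc : ∀ α < δ, #(A α) = ℵ_ 1 := fun α hα => (hA.mem_family α (hlt2 α hα)).1.2.1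
  have hU : Thread.union A (Set.Iio δ) = Thread.union A (C δ) := by
    refine Set.Subset.antisymm ?_ (Thread.union_mono hclub.subset)
    rintro x ⟨α, hα, hx⟩
    obtain ⟨γ, hγ, hαγ⟩ := hclub.unbounded α hα
    exact ⟨γ, hγ, hA.mono γ (hlt2 γ (hclub.subset γ hγ)) α hαγ hx⟩
  have h0 : 0 < δ := _root_.pos_iff_ne_zero.2 (Ordinal.isSuccLimit_iff.1 hδ.isSuccLimit).1
  have hUc : #(Thread.union A (Set.Iio δ)) = ℵ_ 1 := by
    apply le_antisymm
    · rw [Thread.union_eq_biUnion]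
      exact mk_biUnion_le_of_le aleph0_le_aleph_one (mk_Iio_le_aleph_one hδ.lt)
        fun α hα => (hAc α hα).le
    · rw [← hAc 0 h0]
      exact mk_le_mk_of_subset fun x hx => ⟨0, h0, hx⟩
  have hel := hA.isElemSubmodel_union (D := Set.Iio δ) (fun α hα => hlt2 α hα) ⟨0, h0⟩
  rw [hU] at hUc hel ⊢
  have hAle : ∀ γ ∈ C δ, #(A γ) ≤ ℵ_ 1 := fun γ hγ => (hAc γ (hclub.subset γ hγ)).le
  refine ⟨hel, hUc, _, Thread.isWellOrder_lt_subtype (A := A) (C := C δ) _,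
    Thread.type_lt htype hAle hUc, ?_⟩
  rintro ⟨x, hx⟩
  -- Only countably many points of `C δ` have position at most the level of `x`, so a limit point
  -- `β` lies above all of them. The segment at `x` is then computed from `C β` and was put into `A
  -- β`.
  obtain ⟨β, hβ, hlim, hS⟩ := hclub.exists_isLimitPointOf hδ.exists_bound
    (fun γ hγ => hclub.subset γ hγ.1) (countable_posIn_le (C δ) (Thread.level_lt htype hAle hx))
  have hCβ := hcoh β hβ hlim
  obtain ⟨s, hs, hse⟩ := hA.segment_mem β (hlt2 β hβ) (hCβ ▸ Set.inter_subset_right) x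
    (hCβ ▸ (Thread.level_inter_Iio hx hS).1)
  rw [hCβ, Thread.segment_inter_Iio hx hS] at hse
  refine ⟨s, hU ▸ ⟨β, hβ, hs⟩, fun z => ?_⟩
  rw [← SetLike.mem_coe, hse]
  constructor
  · rintro ⟨y, hy, w, hw, h⟩
    exact ⟨⟨y, hy⟩, ⟨w, hw⟩, h⟩
  · rintro ⟨y, w, h⟩
    exact ⟨y, y.2, w, w.2, h⟩

end Chain

/-! ### Assembly of the theorem. -/

theorem SetPoset.SEP.sepPlus (hsq : SquareOmegaOne.{u}) {P : SetPoset.{u}}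
    (hP : P.AlephTwoIDP) (h : P.SEP) : P.SEPPlus := by
  obtain ⟨χ₁, hIDP⟩ := hP
  obtain ⟨χ₂, hSEP⟩ := h
  obtain ⟨C, hC⟩ := hsq
  -- Any `χ` above this cardinal has `P.toSet` in `HSets χ`.
  let κ : Cardinal.{u} := #(Shrink.{u} (trcl P.toSet))
  refine ⟨max (max χ₁ χ₂) (Order.succ (max (ℵ_ 2) κ)), fun χ hχ hr Y hY hYc => ?_⟩
  have hχ₁ : χ₁ ≤ χ := (le_max_left _ _).trans ((le_max_left _ _).trans hχ)
  have hχ₂ : χ₂ ≤ χ := (le_max_right _ _).trans ((le_max_left _ _).trans hχ)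
  have hχ' : max (ℵ_ 2) κ < χ := Order.succ_le_iff.1 ((le_max_right _ _).trans hχ)
  have h2 : ℵ_ 2 < χ := (le_max_left _ _).trans_lt hχ'
  have hPH : P.toSet ∈ HSets χ := by
    change #(trcl P.toSet) < _
    rw [← lift_mk_shrink''.{u + 1, u}]
    exact Cardinal.lift_lt.2 ((le_max_right _ _).trans_lt hχ')
  have hcar : P.carrier ∈ HSets χ := by
    refine HSets.mem_of_mem (HSets.mem_of_mem hPH (y := {P.carrier}) ?_) (by simp)
    simp [SetPoset.toSet, ZFSet.pair]
  have hF : IsCofinalFamily (P.sepModels χ) (HSets χ) := hSEP χ hχ₂ hr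
  -- The IDP speaks only of models that contain `P`, so it is placed in the base of the chain.
  let X : Set ZFSet.{u} := insert P.toSet Y
  have hX : X ⊆ HSets χ := Set.insert_subset hPH hY
  have hXc : #X = ℵ_ 1 := by
    apply le_antisymm
    · exact mk_insert_le.trans (add_le_of_le aleph0_le_aleph_one hYc.le
        (one_le_aleph0.trans aleph0_le_aleph_one))
    · exact hYc ▸ mk_le_mk_of_subset (Set.subset_insert _ _)
  obtain ⟨A, hA⟩ := exists_isModelChain hr h2 hF (fun M hM => ⟨hM.1.1.subset, hM.1.2.1⟩) hX hXc C
  obtain ⟨a, ha⟩ := hA.exists_codes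
  have h0 : (0 : Ordinal.{u}) < ω_ 2 := omega_pos 2
  have hN := hIDP χ hχ₁ hr _ (hA.isElemSubmodel_union subset_rfl ⟨0, h0⟩) hA.mk_union_omega_two
    ⟨0, h0, hA.base_subset 0 h0 (Set.mem_insert _ _)⟩ hA.cofinalCovering_union
  obtain ⟨M, hM, hXM, hR⟩ := hA.exists_isReflecting hr h2 hX hXc hF ha hcar
    fun p hp => hA.exists_dominates hN hp
  obtain ⟨δ, hδ⟩ := hR.exists_isHeight hXc hA ha hM hXM
  refine ⟨Thread.union A (Set.Iio δ), ⟨hδ.mem_orderedGoodModels hC hA, hR.subordSigma hA hM hδ⟩, ?_⟩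
  have hpos : 0 < δ := _root_.pos_iff_ne_zero.2 (Ordinal.isSuccLimit_iff.1 hδ.isSuccLimit).1
  exact fun x hx => ⟨0, hpos, hA.base_subset 0 h0 (Set.mem_insert_of_mem _ hx)⟩

theorem theorem8p14 (hsq : SquareOmegaOne.{u}) (P : SetPoset.{u}) (hP : P.AlephTwoIDP) :
    P.SEP ↔ P.SEPPlus :=
  ⟨fun h => h.sepPlus hsq hP, fun h => h.sep⟩
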